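/- **Setting.** Let $0<L_1<L$, let $R_1,R_2,R_3>0$ be particle radii, let $k^{\rm eff},\sigma^{\rm eff},F,R,T,c_{ini},c_{max},a_0>0$, $0<\epsilon_0\le 1$, and let $t_+^0,i_0,b_0,a_1,a_2,a_3$ be real constants. Put $\kappa=\frac{2RT(1-t_+^0)}{Fc_{ini}}$, $\mathcal X=L^2(0,L)\times\prod_{k=1}^3L^2([L_1,L]\times[0,R_k])$ and $\mathcal Y=L^2(0,L)\times L^2(L_1,L)$. States are $c=(c_1,c_2,c_3,c_4)\in\mathcal X$ ($c_1$ the electrolyte concentration, $c_{k+1}$ the solid concentrations), potentials are $\varphi=(\varphi_1,\varphi_2)=(\varphi_e,\varphi_s)\in\mathcal Y$. Let $$\mathrm{sat}_y(s)=\frac1{1+e^{-a_0s}},\quad \mathrm{sat}(s)=\frac{2b_0}{1+e^{-a_0s}}-b_0,\quad \bar c_{k+1}(x)=\frac1{\epsilon_0R_k}\int_{R_k-\epsilon_0R_k}^{R_k}c_{k+1}(x,r)\,dr,\quad \bar y_k=\mathrm{sat}_y\Big(\frac{\bar c_{k+1}}{c_{max}}\Big),$$ let the open circuit potential be either $U(y)=3.4510-0.009y+0.6687e^{-35y}-0.5e^{-210(1-y)}$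 (charging) or $U(y)=3.4077-0.020269y+0.5e^{-200y}-0.9e^{-30(1-y)}$ (discharging), and let the saturated exchange current density be $$\bar i_k(c,\varphi)=2i_0\sinh\Big(\mathrm{sat}\Big(\frac{F(\varphi_2-\varphi_1-U(\bar y_k))}{2RT}\Big)\Big)\ \text{on }[L_1,L],\qquad \bar i_k=0\ \text{on }[0,L_1).$$ Write $S=\sum_{k=1}^3a_k\bar i_k(c,\varphi)$ and $g_j=\sum_{k=1}^3a_k\,\partial\bar i_k/\partial\varphi_j$, $j=1,2$. **Constraint equations.** For given $c\in\mathcal X$, $I\in\mathbb R$ and $c_1(0)=c_0\in\mathbb R$, they are $$(k^{\rm eff}\varphi_1')'+k^{\rm eff}(\kappa c_1')'+S=0\ \text{ on }(0,L),\qquad (\sigma^{\rm eff}\varphi_2')'-S=0\ \text{ on }(L_1,L),$$ $$\varphi_1(0)=0,\quad \varphi_1'(L)=0,\quad c_1'(L)=0,\quad \varphi_2'(L_1)=0,\quad -\sigma^{\rm eff}\varphi_2'(L)=I,$$ and $\varphi_0=\varphi_2(L_1)$ denotes the boundary value of the solution. They are understood almost everywhere for functions whose first derivative is absolutely continuous.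 Since $c_1$ is only in $L^2(0,L)$ and has no trace, the electrolyte equation is imposed on $\varphi_1+\kappa c_1$: $(k^{\rm eff}(\varphi_1+\kappa c_1)')'+S=0$, $(\varphi_1+\kappa c_1)(0)=\kappa c_0$, $(\varphi_1+\kappa c_1)'(L)=0$. **Operators.** Define $\mathcal O:\mathcal X\times\mathcal Y\times\mathbb R^3\to\mathcal Y\times\mathbb R$ by $$\mathcal O(c,\varphi,I,c_0,\varphi_0)=\begin{bmatrix}k^{\rm eff}\varphi_1-x\int_0^LS\,ds+k^{\rm eff}\kappa(c_1-c_0)+\int_0^x\!\int_0^yS\,ds\,dy\\ \sigma^{\rm eff}(\varphi_2-\varphi_0)-\int_0^x\!\int_0^yS\,ds\,dy\\ I+\int_0^LS\,ds\end{bmatrix}$$ and the bounded linear operator $D\mathcal O(c,\varphi,I,c_0,\varphi_0)$ on $\mathcal Y\times\mathbb R$ by $$\begin{bmatrix}h_1\\h_2\\h_0\end{bmatrix}\mapsto\begin{bmatrix}k^{\rm eff}h_1+\int_0^x\!\int_0^y(g_1h_1+g_2h_2)\,ds\,dy-x\int_0^L(g_1h_1+g_2h_2)\,ds\\ \sigma^{\rm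 eff}h_2-\int_0^x\!\int_0^y(g_1h_1+g_2h_2)\,ds\,dy-\sigma^{\rm eff}h_0\\ \int_0^L(g_1h_1+g_2h_2)\,ds\end{bmatrix}.$$ **Theorem.** (a) For every $(c,\varphi,I,c_0,\varphi_0)\in\mathcal X\times\mathcal Y\times\mathbb R^3$, $\mathcal O(c,\varphi,I,c_0,\varphi_0)=0$ if and only if $\varphi$ solves the constraint equations for $(c,c_0,I)$ with $\varphi_2(L_1)=\varphi_0$. If moreover $c_1$ has an absolutely continuous first derivative with $c_1(0)=c_0$ and $c_1'(L)=0$, this is equivalent to the equations and boundary conditions holding with $\varphi_1'$ and $c_1'$ taken separately. (b) $D\mathcal O$ is at every point the Fréchet derivative of $\mathcal O$ with respect to $(\varphi,\varphi_0)$. (c) Let $(c^*,\varphi^*,I^*,c_0^*,\varphi_0^*)$ satisfy the constraint equations, and let $D\mathcal O$ be nonsingular (boundedly invertible on $\mathcal Y\times\mathbb R$) at this point. Then there are open neighbourhoods $\mathcal U$ of $(c^*,c_0^*,I^*)$ and $\mathcal V$ of $(\varphi^*,\varphi_0^*)$ and a map $\mathcal R_\varphi$ from $\mathcal X\times\mathbb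 R^2$ to $\mathcal Y$, Fréchet differentiable on $\mathcal U$, with $\mathcal R_\varphi(c^*,c_0^*,I^*)=\varphi^*$, such that for every $(c,c_0,I)\in\mathcal U$ the constraint equations have exactly one solution $(\varphi,\varphi_0)$ in $\mathcal V$, and this solution satisfies $\varphi=\mathcal R_\varphi(c,c_0,I)$. -/

import Mathlib

open MeasureTheory Set Filter Topology

noncomputable section

namespace LiCell

/-- Physical constants of a cell with three particle-size bins. -/
structure CellParams where
  /-- thickness of the separator -/
  lSep : ℝ
  /-- thickness of the positive electrode -/
  lCat : ℝ
  /-- particle radii `R_k` -/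
  radius : Fin 3 → ℝ
  /-- effective conductivity of the electrolyte -/
  kEff : ℝ
  /-- effective conductivity of the solid phase -/
  sigmaEff : ℝ
  /-- Faraday constant -/
  F : ℝ
  /-- gas constant -/
  Rg : ℝ
  /-- temperature -/
  T : ℝ
  /-- transference number -/
  tPlus : ℝ
  /-- initial electrolyte concentration -/
  cIni : ℝ
  /-- maximal solid concentration -/
  cMax : ℝ
  /-- exchange current density -/
  i0 : ℝ
  /-- specific interfacial areas `a_k` -/
  a : Fin 3 → ℝ
  /-- slope parameter of both saturation functions -/
  a0 : ℝ
  /-- saturation level -/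
  b0 : ℝ
  /-- relative width of the averaging layer -/
  eps0 : ℝ
  lSep_pos : 0 < lSep
  lCat_pos : 0 < lCat
  radius_pos : ∀ k, 0 < radius k
  kEff_pos : 0 < kEff
  sigmaEff_pos : 0 < sigmaEff
  F_pos : 0 < F
  Rg_pos : 0 < Rg
  T_pos : 0 < T
  cIni_pos : 0 < cIni
  cMax_pos : 0 < cMax
  a0_pos : 0 < a0
  eps0_pos : 0 < eps0
  eps0_le_one : eps0 ≤ 1

/-- Operating cycle: selects the open circuit potential. -/
inductive Cycle where
  | charge
  | discharge

/-- Interface between separator and electrode. -/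
def CellParams.L1 (P : CellParams) : ℝ := P.lSep

/-- Total length. -/
def CellParams.L (P : CellParams) : ℝ := P.lSep + P.lCat

/-- The constant `2RT(1 - t₊⁰) / (F c_ini)`. -/
def CellParams.kappa (P : CellParams) : ℝ :=
  2 * P.Rg * P.T * (1 - P.tPlus) / (P.F * P.cIni)

/-- Lebesgue measure on `[0, L]`. -/
abbrev CellParams.muE (P : CellParams) : Measure ℝ := volume.restrict (Icc 0 P.L)

/-- Lebesgue measure on `[L₁, L]`. -/
abbrev CellParams.muS (P : CellParams) : Measure ℝ := volume.restrict (Icc P.L1 P.L)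

/-- Lebesgue measure on `[L₁, L] × [0, R_k]`. -/
abbrev CellParams.muP (P : CellParams) (k : Fin 3) : Measure (ℝ × ℝ) :=
  volume.restrict (Icc P.L1 P.L ×ˢ Icc 0 (P.radius k))

/-- The state space `𝒳`: `c.1` is the electrolyte concentration `c₁` and `c.2 k` is the solid
concentration in the `k`-th bin, a function of `(x, r)`. As `r` is bounded, the requirement that
`r² z` be square integrable as well is automatic. -/
abbrev ConcState (P : CellParams) : Type :=
  Lp ℝ 2 P.muE × ((k : Fin 3) → Lp ℝ 2 (P.muP k))

/-- The space `𝒴` of potentials `(φ₁, φ₂) = (φ_e, φ_s)`. -/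
abbrev PotState (P : CellParams) : Type := Lp ℝ 2 P.muE × Lp ℝ 2 P.muS

/-! ### The saturated exchange current density -/

/-- `sat_y`. -/
def satY (P : CellParams) (s : ℝ) : ℝ := 1 / (1 + Real.exp (-P.a0 * s))

/-- `sat`. -/
def sat (P : CellParams) (s : ℝ) : ℝ := 2 * P.b0 / (1 + Real.exp (-P.a0 * s)) - P.b0

/-- The open circuit potential. -/
def ocp : Cycle → ℝ → ℝ
  | .charge, y =>
      3.4510 - 0.009 * y + 0.6687 * Real.exp (-35 * y) - 0.5 * Real.exp (-210 * (1 - y))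
  | .discharge, y =>
      3.4077 - 0.020269 * y + 0.5 * Real.exp (-200 * y) - 0.9 * Real.exp (-30 * (1 - y))

/-- The approximate delta function concentrated near the right end of `[0, x₀]`. -/
def deltaKernel (ε x₀ x : ℝ) : ℝ :=
  (Icc (x₀ - ε * x₀) x₀).indicator (fun _ => 1 / (ε * x₀)) x

/-- The averaged surface concentration of the `k`-th bin. -/
def cBar (P : CellParams) (c : ConcState P) (k : Fin 3) (x : ℝ) : ℝ :=
  ∫ r in (0 : ℝ)..P.radius k, deltaKernel P.eps0 (P.radius k) r * c.2 k (x, r)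

/-- The reaction rate as a function of the averaged concentration `z` and of the values
`p₁`, `p₂` of the electrolyte and solid potentials. -/
def rate (P : CellParams) (cyc : Cycle) (z p₁ p₂ : ℝ) : ℝ :=
  2 * P.i0 * Real.sinh (sat P (P.F * (p₂ - p₁ - ocp cyc (satY P (z / P.cMax)))
    / (2 * P.Rg * P.T)))

/-- The exchange current density: the reaction takes place in the electrode only. -/
def current (P : CellParams) (cyc : Cycle) (c : ConcState P) (φ : PotState P)
    (k : Fin 3) (x : ℝ) : ℝ :=
  (Icc P.L1 P.L).indicator (fun x => rate P cyc (cBar P c k x) (φ.1 x) (φ.2 x)) x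

/-- The partial derivative of the exchange current density in `φ₁`. -/
def current₁ (P : CellParams) (cyc : Cycle) (c : ConcState P) (φ : PotState P)
    (k : Fin 3) (x : ℝ) : ℝ :=
  (Icc P.L1 P.L).indicator
    (fun x => deriv (fun p => rate P cyc (cBar P c k x) p (φ.2 x)) (φ.1 x)) x

/-- The partial derivative of the exchange current density in `φ₂`. -/
def current₂ (P : CellParams) (cyc : Cycle) (c : ConcState P) (φ : PotState P)
    (k : Fin 3) (x : ℝ) : ℝ :=
  (Icc P.L1 P.L).indicator
    (fun x => deriv (fun p => rate P cyc (cBar P c k x) (φ.1 x) p) (φ.2 x)) x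

/-- The total source `∑ a_k i_k`. -/
def source (P : CellParams) (cyc : Cycle) (c : ConcState P) (φ : PotState P) (x : ℝ) : ℝ :=
  ∑ k, P.a k * current P cyc c φ k x

/-- `∑ a_k ∂i_k/∂φ₁`. -/
def source₁ (P : CellParams) (cyc : Cycle) (c : ConcState P) (φ : PotState P) (x : ℝ) : ℝ :=
  ∑ k, P.a k * current₁ P cyc c φ k x

/-- `∑ a_k ∂i_k/∂φ₂`. -/
def source₂ (P : CellParams) (cyc : Cycle) (c : ConcState P) (φ : PotState P) (x : ℝ) : ℝ :=
  ∑ k, P.a k * current₂ P cyc c φ k x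

/-! ### The constraint equations -/

/-- `u` is a representative of `f` on `[a, b]` with an absolutely continuous derivative `v`
(that is, `f ∈ W^{2,1}(a, b)`). -/
structure IsW2Rep (a b : ℝ) (f u v : ℝ → ℝ) : Prop where
  ae_eq : ∀ᵐ x ∂volume.restrict (Icc a b), u x = f x
  hasDeriv : ∀ x ∈ Icc a b, HasDerivWithinAt u (v x) (Icc a b) x
  absCont : AbsolutelyContinuousOnInterval v a b

/-- The solid part of the constraint equations: `(σ φ₂')' - ∑ a_k i_k = 0` on `(L₁, L)`, with
`φ₂'(L₁) = 0`, `-σ φ₂'(L) = I` and `φ₂(L₁) = φ₀`. -/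
def SolidEq (P : CellParams) (cyc : Cycle) (c : ConcState P) (φ : PotState P)
    (I φ₀ : ℝ) : Prop :=
  ∃ u v : ℝ → ℝ, IsW2Rep P.L1 P.L φ.2 u v ∧
    (∀ᵐ x ∂P.muS, deriv (fun y => P.sigmaEff * v y) x - source P cyc c φ x = 0) ∧
    v P.L1 = 0 ∧ -P.sigmaEff * v P.L = I ∧ u P.L1 = φ₀

/-- `φ` solves the constraint equations with their boundary conditions, for the concentration `c`,
the input current `I`, the boundary value `c₁(0) = c₀`, and with `φ₂(L₁) = φ₀`.
As `c₁` is merely square integrable, the electrolyte part is imposed on the combination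
`φ₁ + κ c₁`, where `κ = 2RT(1 - t₊⁰)/(F c_ini)`: `(k (φ₁ + κ c₁)')' + ∑ a_k i_k = 0` on `(0, L)`;
the conditions `φ₁(0) = 0`, `c₁(0) = c₀` become `(φ₁ + κ c₁)(0) = κ c₀`, and
`φ₁'(L) = 0`, `c₁'(L) = 0` become `(φ₁ + κ c₁)'(L) = 0`. -/
structure IsSolution (P : CellParams) (cyc : Cycle) (c : ConcState P) (φ : PotState P)
    (I c₀ φ₀ : ℝ) : Prop where
  electrolyte : ∃ u v : ℝ → ℝ, IsW2Rep 0 P.L (fun x => φ.1 x + P.kappa * c.1 x) u v ∧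
    (∀ᵐ x ∂P.muE, deriv (fun y => P.kEff * v y) x + source P cyc c φ x = 0) ∧
    u 0 = P.kappa * c₀ ∧ v P.L = 0
  solid : SolidEq P cyc c φ I φ₀

/-- The electrolyte concentration is of class `W^{2,1}`, with `c₁(0) = c₀` and `c₁'(L) = 0`. -/
def IsRegular (P : CellParams) (c : ConcState P) (c₀ : ℝ) : Prop :=
  ∃ u v : ℝ → ℝ, IsW2Rep 0 P.L c.1 u v ∧ u 0 = c₀ ∧ v P.L = 0

/-- The constraint equations with every derivative taken separately and the boundary conditions
`c₁(0) = c₀`, `c₁'(L) = 0`, `φ₁(0) = 0`, `φ₁'(L) = 0`. -/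
structure IsStrongSolution (P : CellParams) (cyc : Cycle) (c : ConcState P) (φ : PotState P)
    (I c₀ φ₀ : ℝ) : Prop where
  electrolyte : ∃ C dC Φ dΦ : ℝ → ℝ, IsW2Rep 0 P.L c.1 C dC ∧ IsW2Rep 0 P.L φ.1 Φ dΦ ∧
    (∀ᵐ x ∂P.muE, deriv (fun y => P.kEff * dΦ y) x
      + P.kEff * deriv (fun y => P.kappa * dC y) x + source P cyc c φ x = 0) ∧
    C 0 = c₀ ∧ dC P.L = 0 ∧ Φ 0 = 0 ∧ dΦ P.L = 0
  solid : SolidEq P cyc c φ I φ₀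

/-! ### Integral operators -/

/-- `x ↦ ∫₀ˣ ∫₀ʸ w(s) ds dy`. -/
def doubleInt (w : ℝ → ℝ) (x : ℝ) : ℝ := ∫ y in (0 : ℝ)..x, ∫ s in (0 : ℝ)..y, w s

/-- Bounded measurable functions supported in the electrode. -/
structure IsWeight (P : CellParams) (g : ℝ → ℝ) : Prop where
  meas : Measurable g
  bdd : ∃ C, 0 ≤ C ∧ ∀ x, |g x| ≤ C
  supp : ∀ x, x ∉ Icc P.L1 P.L → g x = 0

lemma L1_pos (P : CellParams) : 0 < P.L1 := P.lSep_pos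

lemma L1_lt_L (P : CellParams) : P.L1 < P.L := by
  simpa [CellParams.L1, CellParams.L] using P.lCat_pos

lemma Icc_subset (P : CellParams) : Icc P.L1 P.L ⊆ Icc 0 P.L :=
  Icc_subset_Icc_left (L1_pos P).le

lemma continuous_doubleInt {w : ℝ → ℝ} (hw : Integrable w) : Continuous (doubleInt w) := by
  have h1 : Continuous fun y => ∫ s in (0 : ℝ)..y, w s :=
    intervalIntegral.continuous_primitive (fun a b => hw.intervalIntegrable) 0
  exact intervalIntegral.continuous_primitive (fun a b => h1.intervalIntegrable a b) 0

lemma memLp_Icc {f : ℝ → ℝ} (hf : Continuous f) (a b : ℝ) :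
    MemLp f 2 (volume.restrict (Icc a b)) := by
  obtain ⟨C, hC⟩ := isCompact_Icc.exists_bound_of_continuousOn (s := Icc a b) hf.continuousOn
  exact MemLp.of_bound hf.aestronglyMeasurable C
    ((ae_restrict_iff' measurableSet_Icc).2 (Eventually.of_forall hC))

/-- The double integral of an integrable function, as an element of `L²(a, b)`. -/
def doubleIntLp (w : ℝ → ℝ) (hw : Integrable w) (a b : ℝ) : Lp ℝ 2 (volume.restrict (Icc a b)) :=
  (memLp_Icc (continuous_doubleInt hw) a b).toLp (doubleInt w)

/-- The function `x ↦ x` as an element of `L²(0, L)`. -/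
def idLp (P : CellParams) : Lp ℝ 2 P.muE := (memLp_Icc continuous_id 0 P.L).toLp id

lemma IsWeight.integrable_mul {P : CellParams} {g : ℝ → ℝ} (hg : IsWeight P g) {a b : ℝ}
    (hab : Icc P.L1 P.L ⊆ Icc a b) (h : Lp ℝ 2 (volume.restrict (Icc a b))) :
    Integrable (fun s => g s * h s) := by
  obtain ⟨C, hC0, hC⟩ := hg.bdd
  have h1 : Integrable h (volume.restrict (Icc a b)) := (Lp.memLp h).integrable (by norm_num)
  have h2 : IntegrableOn (fun s => g s * h s) (Icc a b) :=
    h1.bdd_mul (c := C) hg.meas.aestronglyMeasurable (Eventually.of_forall hC)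
  refine (integrableOn_iff_integrable_of_support_subset ?_).1 h2
  intro x hx
  by_contra hx'
  exact hx (by simp [hg.supp x (fun hh => hx' (hab hh))])

lemma IsWeight.integrable {P : CellParams} {g : ℝ → ℝ} (hg : IsWeight P g) : Integrable g := by
  obtain ⟨C, hC0, hC⟩ := hg.bdd
  have h2 : IntegrableOn g (Icc P.L1 P.L) :=
    Integrable.of_bound hg.meas.aestronglyMeasurable C (Eventually.of_forall hC)
  refine (integrableOn_iff_integrable_of_support_subset ?_).1 h2
  intro x hx
  by_contra hx'
  exact hx (hg.supp x hx')

lemma IsWeight.exists_bound {P : CellParams} {g : ℝ → ℝ} (hg : IsWeight P g) {a b : ℝ}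
    (hab : Icc P.L1 P.L ⊆ Icc a b) :
    ∃ C, 0 ≤ C ∧ ∀ h : Lp ℝ 2 (volume.restrict (Icc a b)), ∫ s, |g s * h s| ≤ C * ‖h‖ := by
  obtain ⟨C, hC0, hC⟩ := hg.bdd
  set μ := volume.restrict (Icc a b) with hμ
  have hgm : MemLp g 2 μ :=
    MemLp.of_bound hg.meas.aestronglyMeasurable C (Eventually.of_forall hC)
  set G : Lp ℝ 2 μ := (hgm.norm).toLp _ with hG
  refine ⟨‖G‖, norm_nonneg _, fun h => ?_⟩
  have h1 : ∫ s, |g s * h s| = ∫ s, |g s * h s| ∂μ := by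
    refine (setIntegral_eq_integral_of_forall_compl_eq_zero ?_).symm
    intro x hx
    simp [hg.supp x (fun hh => hx (hab hh))]
  have h2 : ∫ s, |g s * h s| ∂μ = inner ℝ G (|h|) := by
    rw [L2.inner_def]
    refine integral_congr_ae ?_
    filter_upwards [(hgm.norm).coeFn_toLp, Lp.coeFn_abs h] with x hx hx'
    rw [hx', hG, hx]
    simp [abs_mul, mul_comm]
  rw [h1, h2]
  calc inner ℝ G (|h|) ≤ ‖G‖ * ‖|h|‖ := real_inner_le_norm _ _
    _ = ‖G‖ * ‖h‖ := by rw [norm_abs_eq_norm]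

lemma integrable_norm_bound {w : ℝ → ℝ} (hw : Integrable w) (y : ℝ) :
    |∫ s in (0 : ℝ)..y, w s| ≤ ∫ s, |w s| := by
  have h := intervalIntegral.norm_integral_le_integral_norm_uIoc (f := w) (a := 0) (b := y)
    (μ := volume)
  refine h.trans ?_
  exact setIntegral_le_integral hw.norm (Eventually.of_forall fun _ => norm_nonneg _)

lemma IsWeight.mul_add_ae {P : CellParams} {g : ℝ → ℝ} (hg : IsWeight P g) {a b : ℝ}
    (hab : Icc P.L1 P.L ⊆ Icc a b) (h h' : Lp ℝ 2 (volume.restrict (Icc a b))) :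
    (fun s => g s * (h + h' : Lp ℝ 2 (volume.restrict (Icc a b))) s) =ᵐ[volume]
      fun s => g s * h s + g s * h' s := by
  have h1 := (ae_restrict_iff' measurableSet_Icc).1 (Lp.coeFn_add h h')
  filter_upwards [h1] with x hx
  by_cases hx' : x ∈ Icc P.L1 P.L
  · rw [hx (hab hx'), Pi.add_apply, mul_add]
  · simp [hg.supp x hx']

lemma IsWeight.mul_smul_ae {P : CellParams} {g : ℝ → ℝ} (hg : IsWeight P g) {a b : ℝ}
    (hab : Icc P.L1 P.L ⊆ Icc a b) (r : ℝ) (h : Lp ℝ 2 (volume.restrict (Icc a b))) :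
    (fun s => g s * (r • h : Lp ℝ 2 (volume.restrict (Icc a b))) s) =ᵐ[volume]
      fun s => r * (g s * h s) := by
  have h1 := (ae_restrict_iff' measurableSet_Icc).1 (Lp.coeFn_smul r h)
  filter_upwards [h1] with x hx
  by_cases hx' : x ∈ Icc P.L1 P.L
  · rw [hx (hab hx'), Pi.smul_apply, smul_eq_mul]; ring
  · simp [hg.supp x hx']

lemma primitive_congr {w w' : ℝ → ℝ} (h : w =ᵐ[volume] w') (y : ℝ) :
    ∫ s in (0 : ℝ)..y, w s = ∫ s in (0 : ℝ)..y, w' s :=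
  intervalIntegral.integral_congr_ae (h.mono fun _ hx _ => hx)

lemma primitive_add {w w' : ℝ → ℝ} (hw : Integrable w) (hw' : Integrable w') (y : ℝ) :
    ∫ s in (0 : ℝ)..y, (w s + w' s) = (∫ s in (0 : ℝ)..y, w s) + ∫ s in (0 : ℝ)..y, w' s :=
  intervalIntegral.integral_add hw.intervalIntegrable hw'.intervalIntegrable

lemma continuous_primitive {w : ℝ → ℝ} (hw : Integrable w) :
    Continuous fun y => ∫ s in (0 : ℝ)..y, w s :=
  intervalIntegral.continuous_primitive (fun _ _ => hw.intervalIntegrable) 0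

/-- The functional `h ↦ ∫₀ᴸ g h`. -/
def intCLM (P : CellParams) (g : ℝ → ℝ) (hg : IsWeight P g) (a b : ℝ)
    (hab : Icc P.L1 P.L ⊆ Icc a b) : Lp ℝ 2 (volume.restrict (Icc a b)) →L[ℝ] ℝ :=
  LinearMap.mkContinuousOfExistsBound
    { toFun := fun h => ∫ s in (0 : ℝ)..P.L, g s * h s
      map_add' := fun h h' => by
        rw [primitive_congr (hg.mul_add_ae hab h h'),
          primitive_add (hg.integrable_mul hab h) (hg.integrable_mul hab h')]
      map_smul' := fun r h => by
        rw [primitive_congr (hg.mul_smul_ae hab r h), intervalIntegral.integral_const_mul]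
        rfl }
    (by
      obtain ⟨C, -, hC⟩ := hg.exists_bound hab
      exact ⟨C, fun h => (integrable_norm_bound (hg.integrable_mul hab h) P.L).trans (hC h)⟩)

/-- The operator `h ↦ ∫₀ˣ ∫₀ʸ g h`, with values in `L²(a', b')`. -/
def doubleIntCLM (P : CellParams) (g : ℝ → ℝ) (hg : IsWeight P g) (a b : ℝ)
    (hab : Icc P.L1 P.L ⊆ Icc a b) (a' b' : ℝ) :
    Lp ℝ 2 (volume.restrict (Icc a b)) →L[ℝ] Lp ℝ 2 (volume.restrict (Icc a' b')) :=
  LinearMap.mkContinuousOfExistsBound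
    { toFun := fun h => doubleIntLp (fun s => g s * h s) (hg.integrable_mul hab h) a' b'
      map_add' := fun h h' => by
        unfold doubleIntLp
        rw [← MemLp.toLp_add]
        congr 1
        funext x
        simp only [doubleInt, Pi.add_apply]
        rw [← intervalIntegral.integral_add
          ((continuous_primitive (hg.integrable_mul hab h)).intervalIntegrable _ _)
          ((continuous_primitive (hg.integrable_mul hab h')).intervalIntegrable _ _)]
        congr 1
        funext y
        rw [primitive_congr (hg.mul_add_ae hab h h'),
          primitive_add (hg.integrable_mul hab h) (hg.integrable_mul hab h')]
      map_smul' := fun r h => by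
        unfold doubleIntLp
        rw [RingHom.id_apply, ← MemLp.toLp_const_smul]
        congr 1
        funext x
        simp only [doubleInt, Pi.smul_apply, smul_eq_mul]
        rw [← intervalIntegral.integral_const_mul]
        congr 1
        funext y
        rw [primitive_congr (hg.mul_smul_ae hab r h), intervalIntegral.integral_const_mul] }
    (by
      obtain ⟨C, hC0, hC⟩ := hg.exists_bound hab
      set ν := volume.restrict (Icc a' b') with hν
      refine ⟨(measureUnivNNReal ν : ℝ) ^ ((2 : ENNReal).toReal)⁻¹ * ((|a'| + |b'|) * C), fun h => ?_⟩
      have hw := hg.integrable_mul hab h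
      have hb : ∀ᵐ x ∂ν, ‖doubleIntLp (fun s => g s * h s) hw a' b' x‖
          ≤ (|a'| + |b'|) * (C * ‖h‖) := by
        filter_upwards [(memLp_Icc (continuous_doubleInt hw) a' b').coeFn_toLp,
          ae_restrict_mem measurableSet_Icc] with x hx hx'
        rw [doubleIntLp, hx, doubleInt]
        have h1 := intervalIntegral.norm_integral_le_of_norm_le_const (a := 0) (b := x)
          (f := fun y => ∫ s in (0 : ℝ)..y, g s * h s) (C := C * ‖h‖)
          (fun y _ => (integrable_norm_bound hw y).trans (hC h))
        refine h1.trans ?_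
        rw [mul_comm, sub_zero]
        refine mul_le_mul_of_nonneg_right ?_ (by positivity)
        refine abs_le.2 ⟨?_, ?_⟩
        · linarith [hx'.1, neg_abs_le a', abs_nonneg b']
        · linarith [hx'.2, le_abs_self b', abs_nonneg a']
      have h2 := Lp.norm_le_of_ae_bound (by positivity) hb
      refine h2.trans (le_of_eq ?_)
      ring)

/-! ### Measurability and boundedness of the current density -/

lemma measurable_satY (P : CellParams) : Measurable (satY P) := by
  unfold satY; fun_prop

lemma measurable_sat (P : CellParams) : Measurable (sat P) := by
  unfold sat; fun_prop

lemma measurable_ocp (cyc : Cycle) : Measurable (ocp cyc) := by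
  cases cyc <;> · unfold ocp; fun_prop

lemma abs_sat_le (P : CellParams) (s : ℝ) : |sat P s| ≤ |P.b0| := by
  have h : 0 < Real.exp (-P.a0 * s) := Real.exp_pos _
  have h1 : sat P s = P.b0 * ((1 - Real.exp (-P.a0 * s)) / (1 + Real.exp (-P.a0 * s))) := by
    unfold sat; field_simp; ring
  rw [h1, abs_mul]
  refine mul_le_of_le_one_right (abs_nonneg _) ?_
  rw [abs_div, abs_of_pos (a := 1 + _) (by positivity), div_le_one (by positivity)]
  exact abs_le.2 ⟨by linarith, by linarith⟩

lemma hasDerivAt_sat (P : CellParams) (s : ℝ) :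
    HasDerivAt (sat P)
      (2 * P.b0 * P.a0 * Real.exp (-P.a0 * s) / (1 + Real.exp (-P.a0 * s)) ^ 2) s := by
  have h : 0 < Real.exp (-P.a0 * s) := Real.exp_pos _
  have h1 : HasDerivAt (fun s => 1 + Real.exp (-P.a0 * s))
      (Real.exp (-P.a0 * s) * (-P.a0 * 1)) s :=
    (((hasDerivAt_id s).const_mul (-P.a0)).exp).const_add 1
  have h2 := ((hasDerivAt_const s (2 * P.b0)).div h1 (by positivity)).sub_const P.b0
  refine h2.congr_deriv ?_
  ring

/-- The derivative of the reaction rate with respect to the overpotential. -/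
def rateDeriv (P : CellParams) (cyc : Cycle) (z p₁ p₂ : ℝ) : ℝ :=
  let e := P.F * (p₂ - p₁ - ocp cyc (satY P (z / P.cMax))) / (2 * P.Rg * P.T)
  2 * P.i0 * (Real.cosh (sat P e) *
    (2 * P.b0 * P.a0 * Real.exp (-P.a0 * e) / (1 + Real.exp (-P.a0 * e)) ^ 2
      * (P.F / (2 * P.Rg * P.T))))

lemma deriv_rate₂ (P : CellParams) (cyc : Cycle) (z p₁ p₂ : ℝ) :
    deriv (fun p => rate P cyc z p₁ p) p₂ = rateDeriv P cyc z p₁ p₂ := by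
  set u := ocp cyc (satY P (z / P.cMax)) with hu
  have h1 : HasDerivAt (fun p => P.F * (p - p₁ - u) / (2 * P.Rg * P.T))
      (P.F * 1 / (2 * P.Rg * P.T)) p₂ :=
    ((((hasDerivAt_id p₂).sub_const p₁).sub_const u).const_mul P.F).div_const _
  have h2 := (((hasDerivAt_sat P _).comp p₂ h1).sinh).const_mul (2 * P.i0)
  rw [mul_one] at h2
  exact h2.deriv

lemma deriv_rate₁ (P : CellParams) (cyc : Cycle) (z p₁ p₂ : ℝ) :
    deriv (fun p => rate P cyc z p p₂) p₁ = -rateDeriv P cyc z p₁ p₂ := by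
  set u := ocp cyc (satY P (z / P.cMax)) with hu
  have h1 : HasDerivAt (fun p => P.F * (p₂ - p - u) / (2 * P.Rg * P.T))
      (P.F * (-1) / (2 * P.Rg * P.T)) p₁ :=
    ((((hasDerivAt_id p₁).const_sub p₂).sub_const u).const_mul P.F).div_const _
  have h2 := (((hasDerivAt_sat P _).comp p₁ h1).sinh).const_mul (2 * P.i0)
  have h3 := h2.deriv
  refine h3.trans ?_
  simp only [rateDeriv, ← hu, Function.comp]
  ring

lemma exists_bound_sinh_sat (P : CellParams) :
    ∃ C, 0 ≤ C ∧ ∀ e, |Real.sinh (sat P e)| ≤ C ∧ Real.cosh (sat P e) ≤ C := by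
  refine ⟨Real.cosh P.b0, (Real.cosh_pos _).le, fun e => ?_⟩
  have h1 : Real.cosh (sat P e) ≤ Real.cosh P.b0 := Real.cosh_le_cosh.2 (abs_sat_le P e)
  refine ⟨le_trans ?_ h1, h1⟩
  refine abs_le_of_sq_le_sq ?_ (Real.cosh_pos _).le
  rw [Real.cosh_sq]
  linarith

lemma exists_bound_rate (P : CellParams) (cyc : Cycle) :
    ∃ C, 0 ≤ C ∧ ∀ z p₁ p₂, |rate P cyc z p₁ p₂| ≤ C := by
  obtain ⟨C, hC0, hC⟩ := exists_bound_sinh_sat P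
  refine ⟨|2 * P.i0| * C, by positivity, fun z p₁ p₂ => ?_⟩
  rw [rate, abs_mul]
  exact mul_le_mul_of_nonneg_left (hC _).1 (abs_nonneg _)

lemma exists_bound_rateDeriv (P : CellParams) (cyc : Cycle) :
    ∃ C, 0 ≤ C ∧ ∀ z p₁ p₂, |rateDeriv P cyc z p₁ p₂| ≤ C := by
  obtain ⟨C, hC0, hC⟩ := exists_bound_sinh_sat P
  refine ⟨|2 * P.i0| * (C * (|2 * P.b0 * P.a0| * |P.F / (2 * P.Rg * P.T)|)), by positivity,
    fun z p₁ p₂ => ?_⟩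
  simp only [rateDeriv]
  set e := P.F * (p₂ - p₁ - ocp cyc (satY P (z / P.cMax))) / (2 * P.Rg * P.T)
  have h : 0 < Real.exp (-P.a0 * e) := Real.exp_pos _
  rw [abs_mul (2 * P.i0), abs_mul (Real.cosh _), abs_mul (_ / _), abs_of_pos (Real.cosh_pos _)]
  refine mul_le_mul_of_nonneg_left ?_ (abs_nonneg _)
  refine mul_le_mul (hC e).2 ?_ (by positivity) hC0
  refine mul_le_mul_of_nonneg_right ?_ (abs_nonneg _)
  rw [mul_div_assoc, abs_mul]
  refine mul_le_of_le_one_right (abs_nonneg _) ?_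
  rw [abs_of_pos (by positivity), div_le_one (by positivity)]
  nlinarith

lemma measurable_cBar (P : CellParams) (c : ConcState P) (k : Fin 3) :
    Measurable (cBar P c k) := by
  have h1 : StronglyMeasurable fun q : ℝ × ℝ =>
      deltaKernel P.eps0 (P.radius k) q.2 * c.2 k (q.1, q.2) := by
    have hd : Measurable (deltaKernel P.eps0 (P.radius k)) :=
      measurable_const.indicator measurableSet_Icc
    exact (hd.comp measurable_snd).stronglyMeasurable.mul (Lp.stronglyMeasurable (c.2 k))
  have h2 := (h1.integral_prod_right' (ν := volume.restrict (Ioc 0 (P.radius k)))).measurable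
  have h3 : cBar P c k = fun x => ∫ r in Ioc 0 (P.radius k),
      deltaKernel P.eps0 (P.radius k) r * c.2 k (x, r) := by
    funext x
    exact intervalIntegral.integral_of_le (P.radius_pos k).le
  rw [h3]
  exact h2

lemma IsWeight.sum {P : CellParams} {g : Fin 3 → ℝ → ℝ} (hg : ∀ k, IsWeight P (g k)) :
    IsWeight P (fun x => ∑ k, P.a k * g k x) := by
  choose C hC0 hC using fun k => (hg k).bdd
  refine ⟨Finset.measurable_fun_sum _ fun k _ => (hg k).meas.const_mul _,
    ⟨∑ k, |P.a k| * C k, Finset.sum_nonneg fun k _ => mul_nonneg (abs_nonneg _) (hC0 k),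
      fun x => ?_⟩, fun x hx => ?_⟩
  · refine (Finset.abs_sum_le_sum_abs _ _).trans (Finset.sum_le_sum fun k _ => ?_)
    rw [abs_mul]
    exact mul_le_mul_of_nonneg_left (hC k x) (abs_nonneg _)
  · exact Finset.sum_eq_zero fun k _ => by rw [(hg k).supp x hx, mul_zero]

lemma IsWeight.indicator {P : CellParams} {f : ℝ → ℝ} (hf : Measurable f)
    (hb : ∃ C, 0 ≤ C ∧ ∀ x, |f x| ≤ C) : IsWeight P ((Icc P.L1 P.L).indicator f) := by
  obtain ⟨C, hC0, hC⟩ := hb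
  refine ⟨hf.indicator measurableSet_Icc, ⟨C, hC0, fun x => ?_⟩,
    fun x hx => indicator_of_notMem hx _⟩
  by_cases hx : x ∈ Icc P.L1 P.L
  · rw [indicator_of_mem hx]; exact hC x
  · rw [indicator_of_notMem hx, abs_zero]; exact hC0

lemma measurable_overpotential (P : CellParams) (cyc : Cycle) (c : ConcState P) (φ : PotState P)
    (k : Fin 3) : Measurable fun x =>
      P.F * (φ.2 x - φ.1 x - ocp cyc (satY P (cBar P c k x / P.cMax))) / (2 * P.Rg * P.T) := by
  have h1 : Measurable (φ.1 : ℝ → ℝ) := (Lp.stronglyMeasurable φ.1).measurable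
  have h2 : Measurable (φ.2 : ℝ → ℝ) := (Lp.stronglyMeasurable φ.2).measurable
  have h3 : Measurable fun x => ocp cyc (satY P (cBar P c k x / P.cMax)) :=
    (measurable_ocp cyc).comp ((measurable_satY P).comp ((measurable_cBar P c k).div_const _))
  exact (((h2.sub h1).sub h3).const_mul P.F).div_const _

lemma isWeight_source (P : CellParams) (cyc : Cycle) (c : ConcState P) (φ : PotState P) :
    IsWeight P (source P cyc c φ) := by
  refine IsWeight.sum fun k => IsWeight.indicator ?_ ?_
  · exact ((Real.measurable_sinh.comp ((measurable_sat P).comp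
      (measurable_overpotential P cyc c φ k))).const_mul (2 * P.i0))
  · obtain ⟨C, hC0, hC⟩ := exists_bound_rate P cyc
    exact ⟨C, hC0, fun x => hC _ _ _⟩

lemma measurable_rateDeriv (P : CellParams) (cyc : Cycle) (c : ConcState P) (φ : PotState P)
    (k : Fin 3) : Measurable fun x => rateDeriv P cyc (cBar P c k x) (φ.1 x) (φ.2 x) := by
  have h1 : Measurable fun e => 2 * P.i0 * (Real.cosh (sat P e) *
    (2 * P.b0 * P.a0 * Real.exp (-P.a0 * e) / (1 + Real.exp (-P.a0 * e)) ^ 2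
      * (P.F / (2 * P.Rg * P.T)))) := by
    have := measurable_sat P
    have h2 := Real.measurable_cosh.comp this
    exact (h2.mul (by fun_prop)).const_mul _
  exact h1.comp (measurable_overpotential P cyc c φ k)

lemma isWeight_source₁ (P : CellParams) (cyc : Cycle) (c : ConcState P) (φ : PotState P) :
    IsWeight P (source₁ P cyc c φ) := by
  refine IsWeight.sum fun k => IsWeight.indicator ?_ ?_
  · simp only [deriv_rate₁]
    exact (measurable_rateDeriv P cyc c φ k).neg
  · obtain ⟨C, hC0, hC⟩ := exists_bound_rateDeriv P cyc
    exact ⟨C, hC0, fun x => by rw [deriv_rate₁, abs_neg]; exact hC _ _ _⟩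

lemma isWeight_source₂ (P : CellParams) (cyc : Cycle) (c : ConcState P) (φ : PotState P) :
    IsWeight P (source₂ P cyc c φ) := by
  refine IsWeight.sum fun k => IsWeight.indicator ?_ ?_
  · simp only [deriv_rate₂]
    exact measurable_rateDeriv P cyc c φ k
  · obtain ⟨C, hC0, hC⟩ := exists_bound_rateDeriv P cyc
    exact ⟨C, hC0, fun x => by rw [deriv_rate₂]; exact hC _ _ _⟩

/-! ### The operator `𝒪` and the operator `D𝒪` -/

/-- The right-hand side of the fixed-point equation for `φ₁`. -/
def O₁ (P : CellParams) (cyc : Cycle) (c : ConcState P) (φ : PotState P) (_I c₀ _φ₀ : ℝ) :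
    Lp ℝ 2 P.muE :=
  ((1 / P.kEff) * ∫ s in (0 : ℝ)..P.L, source P cyc c φ s) • idLp P
    - P.kappa • (c.1 - Lp.const 2 P.muE c₀)
    - (1 / P.kEff) • doubleIntLp (source P cyc c φ) (isWeight_source P cyc c φ).integrable 0 P.L

/-- The right-hand side of the fixed-point equation for `φ₂`. -/
def O₂ (P : CellParams) (cyc : Cycle) (c : ConcState P) (φ : PotState P) (_I _c₀ φ₀ : ℝ) :
    Lp ℝ 2 P.muS :=
  Lp.const 2 P.muS φ₀ + (1 / P.sigmaEff) •
    doubleIntLp (source P cyc c φ) (isWeight_source P cyc c φ).integrable P.L1 P.L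

/-- The total current balance. -/
def O₃ (P : CellParams) (cyc : Cycle) (c : ConcState P) (φ : PotState P) (I _c₀ _φ₀ : ℝ) : ℝ :=
  I + ∫ s in (0 : ℝ)..P.L, source P cyc c φ s

/-- The operator `𝒪(c, φ, I, c₁(0), φ₂(L₁))`. -/
def opO (P : CellParams) (cyc : Cycle) (c : ConcState P) (φ : PotState P) (I c₀ φ₀ : ℝ) :
    PotState P × ℝ :=
  ((P.kEff • (φ.1 - O₁ P cyc c φ I c₀ φ₀), P.sigmaEff • (φ.2 - O₂ P cyc c φ I c₀ φ₀)),
    O₃ P cyc c φ I c₀ φ₀)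

/-- The matrix of operators `D𝒪`, acting on `((h₁, h₂), h₀) ∈ 𝒴 × ℝ`. With
`gⱼ = ∑ a_k ∂i_k/∂φⱼ`, its three rows are
`k h₁ + ∫₀ˣ∫₀ʸ g₁ h₁ - x ∫₀ᴸ g₁ h₁ + ∫₀ˣ∫₀ʸ g₂ h₂ - x ∫₀ᴸ g₂ h₂`,
`-∫₀ˣ∫₀ʸ g₁ h₁ + σ h₂ - ∫₀ˣ∫₀ʸ g₂ h₂ - σ h₀` and
`∫₀ᴸ g₁ h₁ + ∫₀ᴸ g₂ h₂`. -/
def opDO (P : CellParams) (cyc : Cycle) (c : ConcState P) (φ : PotState P) (_I _c₀ _φ₀ : ℝ) :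
    (PotState P × ℝ) →L[ℝ] (PotState P × ℝ) :=
  let π₁ : (PotState P × ℝ) →L[ℝ] Lp ℝ 2 P.muE :=
    (ContinuousLinearMap.fst ℝ _ _).comp (ContinuousLinearMap.fst ℝ _ _)
  let π₂ : (PotState P × ℝ) →L[ℝ] Lp ℝ 2 P.muS :=
    (ContinuousLinearMap.snd ℝ _ _).comp (ContinuousLinearMap.fst ℝ _ _)
  let π₀ : (PotState P × ℝ) →L[ℝ] ℝ := ContinuousLinearMap.snd ℝ _ _
  let D₁ := fun a b => doubleIntCLM P _ (isWeight_source₁ P cyc c φ) 0 P.L (Icc_subset P) a b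
  let D₂ := fun a b => doubleIntCLM P _ (isWeight_source₂ P cyc c φ) P.L1 P.L subset_rfl a b
  let T₁ := intCLM P _ (isWeight_source₁ P cyc c φ) 0 P.L (Icc_subset P)
  let T₂ := intCLM P _ (isWeight_source₂ P cyc c φ) P.L1 P.L subset_rfl
  let X : ℝ →L[ℝ] Lp ℝ 2 P.muE := ContinuousLinearMap.toSpanSingleton ℝ (idLp P)
  let one : ℝ →L[ℝ] Lp ℝ 2 P.muS :=
    ContinuousLinearMap.toSpanSingleton ℝ (Lp.const 2 P.muS (1 : ℝ))
  ((((P.kEff • ContinuousLinearMap.id ℝ _ + D₁ 0 P.L - X.comp T₁).comp π₁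
      + (D₂ 0 P.L - X.comp T₂).comp π₂).prod
    (-(D₁ P.L1 P.L).comp π₁
      + (P.sigmaEff • ContinuousLinearMap.id ℝ _ - D₂ P.L1 P.L).comp π₂
      - P.sigmaEff • one.comp π₀)).prod
    (T₁.comp π₁ + T₂.comp π₂))

end LiCell

end

open LiCell

/-!
The constraint system is equivalent to `𝒪 = 0` because `𝒪` is the system integrated twice, with the
boundary conditions absorbed. A function with an absolutely continuous derivative is recovered
from its second derivative by the fundamental theorem of calculus, and conversely, by Lebesgue's
differentiation theorem, the double primitive of an integrable source solves the equation almost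
everywhere (`opO_eq_zero_iff_isSolution`). The source vanishes on the separator, so primitives
from `0` and from `L₁` agree. When `c₁` is regular, `φ₁` is as regular as `φ₁ + κ c₁`, and the
derivatives split (`isSolution_iff_isStrongSolution`).

The operator `𝒪` is the sum of a bounded linear map and a bounded linear image of the source, seen
as an element of `L¹`. The point is that the source is a substitution operator from `L²` to `L¹`.
The saturations make the reaction rate a smooth function of sigmoids, so its first-order Taylor
remainder is at most a constant times the square of the increment, uniformly in the base point
(`exists_rate_taylor`). Averaging of the solid concentrations is bounded on `L²`
(`exists_eLpNorm_cBar_le`), and squares of `L²` functions are integrable, so the substitution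
operator has a uniformly quadratic Taylor remainder too (`exists_sourceL1_quadratic`). Any map with
that property is continuously differentiable, its derivative being Lipschitz
(`contDiff_of_quadratic`). Hence `𝒪` is of class `C¹` jointly in all variables, and `D𝒪` is its
partial derivative in `(φ, φ₀)`. When `D𝒪` is invertible, the implicit function theorem
(`exists_implicit_neighborhoods`) gives the local solution operator.
-/

noncomputable section

namespace LiCell

/-! ### Scalar nonlinearities with a globally Lipschitz derivative -/

/-- `f` has a bounded derivative and a quadratic first-order Taylor remainder, with the same
constant `M` in both bounds and uniformly on the line. -/
structure HasTaylorBound (f : ℝ → ℝ) (M : ℝ) : Prop where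
  nonneg : 0 ≤ M
  deriv_le : ∀ x, |deriv f x| ≤ M
  lipschitz : ∀ x y, |f y - f x| ≤ M * |y - x|
  taylor : ∀ x y, |f y - f x - deriv f x * (y - x)| ≤ M * (y - x) ^ 2

lemma HasTaylorBound.of_hasDerivAt {f f' f'' : ℝ → ℝ} {M : ℝ}
    (h : ∀ x, HasDerivAt f (f' x) x) (h' : ∀ x, HasDerivAt f' (f'' x) x)
    (hM : ∀ x, |f' x| ≤ M) (hM' : ∀ x, |f'' x| ≤ M) : HasTaylorBound f M := by
  have hd : deriv f = f' := funext fun x => (h x).deriv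
  have hM0 : 0 ≤ M := (abs_nonneg _).trans (hM 0)
  have hlip : ∀ x y, |f' y - f' x| ≤ M * |y - x| := fun x y =>
    convex_univ.norm_image_sub_le_of_norm_hasDerivWithin_le
      (fun z _ => (h' z).hasDerivWithinAt) (fun z _ => hM' z) (mem_univ x) (mem_univ y)
  refine ⟨hM0, by simpa [hd] using hM, fun x y =>
    convex_univ.norm_image_sub_le_of_norm_hasDerivWithin_le
      (fun z _ => (h z).hasDerivWithinAt) (fun z _ => hM z) (mem_univ x) (mem_univ y),
    fun x y => ?_⟩
  -- the mean value inequality for `t ↦ f t - f' x * t` between `x` and `y`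
  have hg : ∀ t ∈ uIcc x y, HasDerivWithinAt (fun t => f t - f' x * t) (f' t - f' x)
      (uIcc x y) t := fun t _ => by
    simpa using ((h t).fun_sub ((hasDerivAt_id t).const_mul (f' x))).hasDerivWithinAt
  have hb : ∀ t ∈ uIcc x y, ‖f' t - f' x‖ ≤ M * |y - x| := fun t ht =>
    (hlip x t).trans (mul_le_mul_of_nonneg_left (abs_sub_left_of_mem_uIcc ht) hM0)
  have key := (convex_uIcc x y).norm_image_sub_le_of_norm_hasDerivWithin_le hg hb
    left_mem_uIcc right_mem_uIcc
  have e1 : M * |y - x| * ‖y - x‖ = M * (y - x) ^ 2 := by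
    rw [Real.norm_eq_abs, mul_assoc, ← sq, sq_abs]
  rw [e1, Real.norm_eq_abs] at key
  rw [hd]
  convert key using 2
  ring

/-- A smooth function of a sigmoid has bounded first and second derivatives: the sigmoid takes its
values in `[0, 1]` and satisfies `S' = S (1 - S)`, so these derivatives are again continuous
functions of the sigmoid. -/
lemma exists_hasTaylorBound_comp_sigmoid {H : ℝ → ℝ} (hH : ContDiff ℝ 2 H) (r : ℝ) :
    ∃ M, HasTaylorBound (fun t => H (Real.sigmoid (r * t))) M := by
  -- `D` turns `K` into the function whose composition with the sigmoid is the derivative of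
  -- `t ↦ K (sigmoid (r * t))`
  set D : (ℝ → ℝ) → ℝ → ℝ := fun K y => deriv K y * (r * (y * (1 - y))) with hD
  have hder : ∀ K : ℝ → ℝ, Differentiable ℝ K → ∀ t,
      HasDerivAt (fun t => K (Real.sigmoid (r * t))) (D K (Real.sigmoid (r * t))) t := by
    intro K hK t
    have h1 : HasDerivAt (fun t => r * t) r t := by
      simpa using (hasDerivAt_id t).const_mul r
    have h2 := (hK (Real.sigmoid (r * t))).hasDerivAt.comp t
      ((Real.hasDerivAt_sigmoid (r * t)).comp t h1)
    refine h2.congr_deriv ?_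
    simp only [hD]
    ring
  have hbd : ∀ K : ℝ → ℝ, Continuous K → ∃ M, ∀ t, |K (Real.sigmoid (r * t))| ≤ M := by
    intro K hK
    obtain ⟨M, hM⟩ := isCompact_Icc.exists_bound_of_continuousOn (s := Icc (0 : ℝ) 1)
      hK.continuousOn
    exact ⟨M, fun t => hM _ ⟨Real.sigmoid_nonneg _, Real.sigmoid_le_one _⟩⟩
  have hdH : ContDiff ℝ 1 (deriv H) := ((contDiff_succ_iff_deriv (n := 1)).1 hH).2.2
  have hDH : ContDiff ℝ 1 (D H) := hdH.mul (by fun_prop)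
  have hDDc : Continuous (D (D H)) := (hDH.continuous_deriv le_rfl).mul (by fun_prop)
  obtain ⟨M₁, h₁⟩ := hbd _ hDH.continuous
  obtain ⟨M₂, h₂⟩ := hbd _ hDDc
  exact ⟨max M₁ M₂, HasTaylorBound.of_hasDerivAt (hder H (hH.differentiable (by norm_num)))
    (hder _ (hDH.differentiable (by norm_num))) (fun x => (h₁ x).trans (le_max_left _ _))
    (fun x => (h₂ x).trans (le_max_right _ _))⟩

/-! ### The reaction rate -/

/-- The reaction rate as a function of the overpotential `φ₂ - φ₁ - U`. -/
def kinetics (P : CellParams) (q : ℝ) : ℝ :=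
  2 * P.i0 * Real.sinh (sat P (P.F * q / (2 * P.Rg * P.T)))

/-- The open circuit potential as a function of the averaged surface concentration. -/
def ocpOf (P : CellParams) (cyc : Cycle) (z : ℝ) : ℝ := ocp cyc (satY P (z / P.cMax))

lemma rate_eq (P : CellParams) (cyc : Cycle) (z p₁ p₂ : ℝ) :
    rate P cyc z p₁ p₂ = kinetics P (p₂ - p₁ - ocpOf P cyc z) := rfl

lemma satY_eq_sigmoid (P : CellParams) (s : ℝ) : satY P s = Real.sigmoid (P.a0 * s) := by
  rw [satY, Real.sigmoid_def, one_div, neg_mul]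

lemma sat_eq_sigmoid (P : CellParams) (s : ℝ) :
    sat P s = 2 * P.b0 * Real.sigmoid (P.a0 * s) - P.b0 := by
  rw [sat, Real.sigmoid_def, neg_mul, div_eq_mul_inv]

lemma exists_hasTaylorBound_kinetics (P : CellParams) :
    ∃ M, HasTaylorBound (kinetics P) M := by
  obtain ⟨M, hM⟩ := exists_hasTaylorBound_comp_sigmoid
    (H := fun y => 2 * P.i0 * Real.sinh (2 * P.b0 * y - P.b0)) (by fun_prop)
    (P.a0 * (P.F / (2 * P.Rg * P.T)))
  refine ⟨M, ?_⟩
  convert hM using 1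
  funext q
  rw [kinetics, sat_eq_sigmoid]
  ring_nf

lemma contDiff_ocp (cyc : Cycle) : ContDiff ℝ 2 (ocp cyc) := by
  cases cyc <;> · unfold ocp; fun_prop

lemma exists_hasTaylorBound_ocpOf (P : CellParams) (cyc : Cycle) :
    ∃ M, HasTaylorBound (ocpOf P cyc) M := by
  obtain ⟨M, hM⟩ := exists_hasTaylorBound_comp_sigmoid (contDiff_ocp cyc) (P.a0 / P.cMax)
  refine ⟨M, ?_⟩
  convert hM using 1
  funext z
  rw [ocpOf, satY_eq_sigmoid]
  ring_nf

lemma rateDeriv_eq (P : CellParams) (cyc : Cycle) (z p₁ p₂ : ℝ) :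
    rateDeriv P cyc z p₁ p₂ = deriv (kinetics P) (p₂ - p₁ - ocpOf P cyc z) := by
  rw [← deriv_rate₂]
  simp only [rate_eq, sub_sub]
  exact deriv_comp_sub_const (kinetics P) _ _

/-- The derivative of the reaction rate with respect to the averaged concentration. -/
def rateDerivConc (P : CellParams) (cyc : Cycle) (z p₁ p₂ : ℝ) : ℝ :=
  -(rateDeriv P cyc z p₁ p₂ * deriv (ocpOf P cyc) z)

lemma exists_bound_rateDerivConc (P : CellParams) (cyc : Cycle) :
    ∃ C, 0 ≤ C ∧ ∀ z p₁ p₂, |rateDerivConc P cyc z p₁ p₂| ≤ C := by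
  obtain ⟨C, hC0, hC⟩ := exists_bound_rateDeriv P cyc
  obtain ⟨M, hM⟩ := exists_hasTaylorBound_ocpOf P cyc
  refine ⟨C * M, mul_nonneg hC0 hM.nonneg, fun z p₁ p₂ => ?_⟩
  rw [rateDerivConc, abs_neg, abs_mul]
  exact mul_le_mul (hC _ _ _) (hM.deriv_le _) (abs_nonneg _) hC0

/-- Taylor's formula for the reaction rate, with a quadratic remainder that is uniform in the
base point. -/
lemma exists_rate_taylor (P : CellParams) (cyc : Cycle) :
    ∃ C, 0 ≤ C ∧ ∀ z p₁ p₂ dz d₁ d₂,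
      |rate P cyc (z + dz) (p₁ + d₁) (p₂ + d₂) - rate P cyc z p₁ p₂
        - (rateDerivConc P cyc z p₁ p₂ * dz - rateDeriv P cyc z p₁ p₂ * d₁
          + rateDeriv P cyc z p₁ p₂ * d₂)| ≤ C * (dz ^ 2 + d₁ ^ 2 + d₂ ^ 2) := by
  obtain ⟨M, hM⟩ := exists_hasTaylorBound_kinetics P
  obtain ⟨K, hK⟩ := exists_hasTaylorBound_ocpOf P cyc
  have hM0 := hM.nonneg
  have hK0 := hK.nonneg
  refine ⟨M * (3 * K ^ 2 + 3 + K), by positivity, fun z p₁ p₂ dz d₁ d₂ => ?_⟩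
  simp only [rateDerivConc, rateDeriv_eq, rate_eq]
  set q := p₂ - p₁ - ocpOf P cyc z with hq
  set v := ocpOf P cyc (z + dz) - ocpOf P cyc z with hv
  have h1 := hM.taylor q (q + (d₂ - d₁ - v))
  have h2 := hK.taylor z (z + dz)
  have h3 := hK.lipschitz z (z + dz)
  have h4 := hM.deriv_le q
  rw [add_sub_cancel_left] at h1 h2 h3
  have h3' : v ^ 2 ≤ K ^ 2 * dz ^ 2 := by
    rw [← sq_abs, ← sq_abs dz, ← mul_pow]
    exact pow_le_pow_left₀ (abs_nonneg _) h3 2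
  have e1 : p₂ + d₂ - (p₁ + d₁) - ocpOf P cyc (z + dz) = q + (d₂ - d₁ - v) := by
    simp only [hq, hv]; ring
  have h5 : |deriv (kinetics P) q * (v - deriv (ocpOf P cyc) z * dz)| ≤ M * (K * dz ^ 2) := by
    rw [abs_mul]
    exact mul_le_mul h4 h2 (abs_nonneg _) hM0
  have h6 : (d₂ - d₁ - v) ^ 2 ≤ 3 * (d₁ ^ 2 + d₂ ^ 2 + v ^ 2) := by
    nlinarith [sq_nonneg (d₂ + d₁), sq_nonneg (d₁ - v), sq_nonneg (d₂ + v)]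
  rw [e1]
  -- the remainder is that of the kinetics for the increment `d₂ - d₁ - v` of the overpotential,
  -- minus that of the open circuit potential
  have e2 : kinetics P (q + (d₂ - d₁ - v)) - kinetics P q
      - (-(deriv (kinetics P) q * deriv (ocpOf P cyc) z) * dz - deriv (kinetics P) q * d₁
        + deriv (kinetics P) q * d₂)
      = (kinetics P (q + (d₂ - d₁ - v)) - kinetics P q - deriv (kinetics P) q * (d₂ - d₁ - v))
        - deriv (kinetics P) q * (v - deriv (ocpOf P cyc) z * dz) := by ring
  rw [e2]
  refine (abs_sub _ _).trans ?_
  calc _ ≤ M * (d₂ - d₁ - v) ^ 2 + M * (K * dz ^ 2) := add_le_add h1 h5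
    _ ≤ M * (3 * (d₁ ^ 2 + d₂ ^ 2 + K ^ 2 * dz ^ 2)) + M * (K * dz ^ 2) := by
        gcongr
        linarith
    _ ≤ M * (3 * K ^ 2 + 3 + K) * (dz ^ 2 + d₁ ^ 2 + d₂ ^ 2) := by
        have : 0 ≤ M * (3 * dz ^ 2 + (3 * K ^ 2 + K) * (d₁ ^ 2 + d₂ ^ 2)) := by positivity
        linarith

/-! ### Maps with a quadratic Taylor remainder -/

section Quadratic

variable {E G : Type*} [NormedAddCommGroup E] [NormedSpace ℝ E] [NormedAddCommGroup G]
  [NormedSpace ℝ G] {f : E → G} {A : E → E →L[ℝ] G} {C : ℝ}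

lemma hasFDerivAt_of_quadratic (h : ∀ u k, ‖f (u + k) - f u - A u k‖ ≤ C * ‖k‖ ^ 2) (u : E) :
    HasFDerivAt f (A u) u := by
  rw [hasFDerivAt_iff_isLittleO_nhds_zero]
  refine (Asymptotics.IsBigO.of_bound (g := fun k : E => ‖k‖ ^ 2) C
    (Eventually.of_forall fun k => ?_)).trans_isLittleO
      (Asymptotics.isLittleO_norm_pow_id one_lt_two)
  simpa using h u k

/-- A quadratic remainder that is uniform in the base point makes the derivative Lipschitz:
`f (u + k + h)` is expanded around `u` both directly and through `u + k`, with `‖h‖ = ‖k‖`. -/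
lemma lipschitz_of_quadratic (h : ∀ u k, ‖f (u + k) - f u - A u k‖ ≤ C * ‖k‖ ^ 2) (u v : E) :
    ‖A v - A u‖ ≤ 6 * C * ‖v - u‖ := by
  rcases eq_or_ne v u with rfl | hne
  · simp
  obtain ⟨k, rfl⟩ : ∃ k, v = u + k := ⟨v - u, by abel⟩
  have hk : 0 < ‖k‖ := by
    rw [norm_pos_iff]; rintro rfl; simp at hne
  have hC : 0 ≤ C := by
    have := (norm_nonneg _).trans (h u k)
    exact nonneg_of_mul_nonneg_left this (by positivity)
  have key : ∀ w : E, ‖w‖ = ‖k‖ → ‖(A (u + k) - A u) w‖ ≤ 6 * C * ‖k‖ ^ 2 := by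
    intro w hw
    have h1 := h (u + k) w
    have h2 := h u (k + w)
    have h3 := h u k
    have hkw : ‖k + w‖ ≤ 2 * ‖k‖ := by
      refine (norm_add_le _ _).trans ?_
      rw [hw]; linarith
    have e : (A (u + k) - A u) w = (f (u + (k + w)) - f u - A u (k + w))
        - (f (u + k + w) - f (u + k) - A (u + k) w) - (f (u + k) - f u - A u k) := by
      rw [sub_apply, map_add, ← add_assoc]
      abel
    have h4 : ‖k + w‖ ^ 2 ≤ (2 * ‖k‖) ^ 2 := pow_le_pow_left₀ (norm_nonneg _) hkw 2
    rw [e]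
    rw [hw] at h1
    calc _ ≤ C * ‖k + w‖ ^ 2 + C * ‖k‖ ^ 2 + C * ‖k‖ ^ 2 :=
          (norm_sub_le _ _).trans (add_le_add ((norm_sub_le _ _).trans (add_le_add h2 h1)) h3)
      _ ≤ C * (2 * ‖k‖) ^ 2 + C * ‖k‖ ^ 2 + C * ‖k‖ ^ 2 := by gcongr
      _ = 6 * C * ‖k‖ ^ 2 := by ring
  rw [add_sub_cancel_left]
  refine ContinuousLinearMap.opNorm_le_bound _ (by positivity) fun w => ?_
  rcases eq_or_ne w 0 with rfl | hw
  · simp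
  have hw' : 0 < ‖w‖ := norm_pos_iff.2 hw
  -- the bound is homogeneous in `w`, so it suffices to rescale `w` to the norm of `k`
  have h5 := key ((‖k‖ / ‖w‖) • w) (by
    rw [norm_smul, Real.norm_of_nonneg (by positivity)]; field_simp)
  rw [map_smul, norm_smul, Real.norm_of_nonneg (by positivity)] at h5
  have h6 : ‖(A (u + k) - A u) w‖ = ‖w‖ / ‖k‖ * (‖k‖ / ‖w‖ * ‖(A (u + k) - A u) w‖) := by
    field_simp
  rw [h6]
  calc _ ≤ ‖w‖ / ‖k‖ * (6 * C * ‖k‖ ^ 2) := by gcongr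
    _ = _ := by field_simp

lemma contDiff_of_quadratic (h : ∀ u k, ‖f (u + k) - f u - A u k‖ ≤ C * ‖k‖ ^ 2) :
    ContDiff ℝ 1 f := by
  have hd := hasFDerivAt_of_quadratic h
  refine contDiff_one_iff_fderiv.2 ⟨fun u => (hd u).differentiableAt, ?_⟩
  have e : fderiv ℝ f = A := funext fun u => (hd u).fderiv
  rw [e, continuous_iff_continuousAt]
  intro u
  rw [ContinuousAt, tendsto_iff_norm_sub_tendsto_zero]
  refine squeeze_zero (fun _ => norm_nonneg _) (fun v => lipschitz_of_quadratic h u v) ?_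
  have : Continuous fun v : E => 6 * C * ‖v - u‖ := by fun_prop
  simpa using this.tendsto u

end Quadratic

/-! ### Integral operators on `L¹` -/

lemma doubleInt_congr {w w' : ℝ → ℝ} (h : w =ᵐ[volume] w') : doubleInt w = doubleInt w' := by
  funext x
  simp only [doubleInt, primitive_congr h]

lemma doubleIntLp_congr {w w' : ℝ → ℝ} (hw : Integrable w) (hw' : Integrable w')
    (h : w =ᵐ[volume] w') (a b : ℝ) : doubleIntLp w hw a b = doubleIntLp w' hw' a b := by
  unfold doubleIntLp
  congr 1
  exact doubleInt_congr h

/-- The functional `w ↦ ∫₀ᵇ w` on `L¹(ℝ)`. -/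
def primitiveL1 (b : ℝ) : (ℝ →₁[volume] ℝ) →L[ℝ] ℝ :=
  LinearMap.mkContinuous
    { toFun := fun w => ∫ s in (0 : ℝ)..b, w s
      map_add' := fun w w' => by
        rw [primitive_congr (Lp.coeFn_add w w')]
        exact primitive_add (L1.integrable_coeFn w) (L1.integrable_coeFn w') b
      map_smul' := fun r w => by
        rw [primitive_congr (Lp.coeFn_smul r w)]
        exact intervalIntegral.integral_const_mul _ _ }
    1 (fun w => by
      rw [one_mul, L1.norm_eq_integral_norm]
      exact integrable_norm_bound (L1.integrable_coeFn w) b)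

lemma primitiveL1_toL1 (b : ℝ) {w : ℝ → ℝ} (hw : Integrable w) :
    primitiveL1 b hw.toL1 = ∫ s in (0 : ℝ)..b, w s :=
  primitive_congr hw.coeFn_toL1 b

/-- The operator `w ↦ ∫₀ˣ ∫₀ʸ w` from `L¹(ℝ)` to `L²(a, b)`. -/
def doubleIntL1 (a b : ℝ) : (ℝ →₁[volume] ℝ) →L[ℝ] Lp ℝ 2 (volume.restrict (Icc a b)) :=
  LinearMap.mkContinuousOfExistsBound
    { toFun := fun w => doubleIntLp w (L1.integrable_coeFn w) a b
      map_add' := fun w w' => by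
        have hw := L1.integrable_coeFn w
        have hw' := L1.integrable_coeFn w'
        rw [doubleIntLp_congr _ (hw.add hw') (Lp.coeFn_add w w')]
        unfold doubleIntLp
        rw [← MemLp.toLp_add]
        congr 1
        funext x
        simp only [doubleInt, Pi.add_apply, primitive_add hw hw']
        exact intervalIntegral.integral_add
          ((continuous_primitive hw).intervalIntegrable _ _)
          ((continuous_primitive hw').intervalIntegrable _ _)
      map_smul' := fun r w => by
        have hw := L1.integrable_coeFn w
        rw [RingHom.id_apply, doubleIntLp_congr _ (hw.smul r) (Lp.coeFn_smul r w)]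
        unfold doubleIntLp
        rw [← MemLp.toLp_const_smul]
        congr 1
        funext x
        simp only [doubleInt, Pi.smul_apply, smul_eq_mul, intervalIntegral.integral_const_mul] }
    (by
      set ν := volume.restrict (Icc a b) with hν
      refine ⟨(measureUnivNNReal ν : ℝ) ^ ((2 : ENNReal).toReal)⁻¹ * (|a| + |b|), fun w => ?_⟩
      have hw := L1.integrable_coeFn w
      have hb : ∀ᵐ x ∂ν, ‖doubleIntLp w hw a b x‖ ≤ (|a| + |b|) * ‖w‖ := by
        filter_upwards [(memLp_Icc (continuous_doubleInt hw) a b).coeFn_toLp,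
          ae_restrict_mem measurableSet_Icc] with x hx hx'
        rw [doubleIntLp, hx, doubleInt]
        have h1 := intervalIntegral.norm_integral_le_of_norm_le_const (a := 0) (b := x)
          (f := fun y => ∫ s in (0 : ℝ)..y, w s) (C := ‖w‖)
          (fun y _ => by
            rw [L1.norm_eq_integral_norm]
            exact integrable_norm_bound hw y)
        refine h1.trans ?_
        rw [mul_comm, sub_zero]
        refine mul_le_mul_of_nonneg_right ?_ (by positivity)
        refine abs_le.2 ⟨?_, ?_⟩
        · linarith [hx'.1, neg_abs_le a, abs_nonneg b]
        · linarith [hx'.2, le_abs_self b, abs_nonneg a]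
      have h2 := Lp.norm_le_of_ae_bound (by positivity) hb
      refine h2.trans (le_of_eq ?_)
      ring)

lemma doubleIntL1_toL1 (a b : ℝ) {w : ℝ → ℝ} (hw : Integrable w) :
    doubleIntL1 a b hw.toL1 = doubleIntLp w hw a b :=
  doubleIntLp_congr (L1.integrable_coeFn _) hw hw.coeFn_toL1 a b

/-- Multiplication by a weight, as an operator from `L²(a, b)` to `L¹(ℝ)`. -/
def IsWeight.mulL1 {P : CellParams} {g : ℝ → ℝ} (hg : IsWeight P g) {a b : ℝ}
    (hab : Icc P.L1 P.L ⊆ Icc a b) :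
    Lp ℝ 2 (volume.restrict (Icc a b)) →L[ℝ] (ℝ →₁[volume] ℝ) :=
  LinearMap.mkContinuousOfExistsBound
    { toFun := fun h => (hg.integrable_mul hab h).toL1
      map_add' := fun h h' => by
        rw [← Integrable.toL1_add _ _ (hg.integrable_mul hab h) (hg.integrable_mul hab h')]
        exact (Integrable.toL1_eq_toL1_iff _ _ _ _).2 (hg.mul_add_ae hab h h')
      map_smul' := fun r h => by
        rw [RingHom.id_apply, ← Integrable.toL1_smul' _ (hg.integrable_mul hab h)]
        exact (Integrable.toL1_eq_toL1_iff _ _ _ _).2 (hg.mul_smul_ae hab r h) }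
    (by
      obtain ⟨C, -, hC⟩ := hg.exists_bound hab
      refine ⟨C, fun h => ?_⟩
      refine le_trans (le_of_eq ?_) (hC h)
      exact L1.norm_of_fun_eq_integral_norm (hg.integrable_mul hab h))

lemma primitiveL1_comp_mulL1 {P : CellParams} {g : ℝ → ℝ} (hg : IsWeight P g) {a b : ℝ}
    (hab : Icc P.L1 P.L ⊆ Icc a b) (h : Lp ℝ 2 (volume.restrict (Icc a b))) :
    primitiveL1 P.L (hg.mulL1 hab h) = intCLM P g hg a b hab h :=
  primitiveL1_toL1 _ (hg.integrable_mul hab h)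

lemma doubleIntL1_comp_mulL1 {P : CellParams} {g : ℝ → ℝ} (hg : IsWeight P g) {a b : ℝ}
    (hab : Icc P.L1 P.L ⊆ Icc a b) (a' b' : ℝ) (h : Lp ℝ 2 (volume.restrict (Icc a b))) :
    doubleIntL1 a' b' (hg.mulL1 hab h) = doubleIntCLM P g hg a b hab a' b' h :=
  doubleIntL1_toL1 _ _ (hg.integrable_mul hab h)

/-! ### The averaged concentration as a bounded operator -/

lemma muP_eq_prod (P : CellParams) (k : Fin 3) :
    P.muP k = P.muS.prod (volume.restrict (Icc 0 (P.radius k))) := by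
  rw [Measure.prod_restrict]
  rfl

lemma ae_ae_of_ae_muP {P : CellParams} {k : Fin 3} {p : ℝ × ℝ → Prop}
    (h : ∀ᵐ q ∂P.muP k, p q) :
    ∀ᵐ x ∂P.muS, ∀ᵐ r ∂volume.restrict (Icc 0 (P.radius k)), p (x, r) :=
  Measure.ae_ae_of_ae_prod (by rwa [← muP_eq_prod])

lemma ae_integrable_of_muP {P : CellParams} {k : Fin 3} {f : ℝ × ℝ → ℝ}
    (h : Integrable f (P.muP k)) :
    ∀ᵐ x ∂P.muS, Integrable (fun r => f (x, r)) (volume.restrict (Icc 0 (P.radius k))) := by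
  rw [muP_eq_prod] at h
  exact h.prod_right_ae

lemma lintegral_muP {P : CellParams} {k : Fin 3} {f : ℝ × ℝ → ENNReal} (hf : Measurable f) :
    ∫⁻ q, f q ∂P.muP k
      = ∫⁻ x, ∫⁻ r, f (x, r) ∂volume.restrict (Icc 0 (P.radius k)) ∂P.muS := by
  rw [muP_eq_prod, lintegral_prod _ hf.aemeasurable]

lemma measurable_deltaKernel (ε x₀ : ℝ) : Measurable (deltaKernel ε x₀) :=
  measurable_const.indicator measurableSet_Icc

lemma abs_deltaKernel_le (ε x₀ x : ℝ) : |deltaKernel ε x₀ x| ≤ |1 / (ε * x₀)| := by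
  unfold deltaKernel
  by_cases hx : x ∈ Icc (x₀ - ε * x₀) x₀
  · rw [indicator_of_mem hx]
  · rw [indicator_of_notMem hx, abs_zero]
    exact abs_nonneg _

lemma cBar_eq_setIntegral (P : CellParams) (c : ConcState P) (k : Fin 3) (x : ℝ) :
    cBar P c k x = ∫ r in Icc 0 (P.radius k),
      deltaKernel P.eps0 (P.radius k) r * c.2 k (x, r) := by
  rw [cBar, intervalIntegral.integral_of_le (P.radius_pos k).le, integral_Icc_eq_integral_Ioc]

lemma ae_integrable_cBar (P : CellParams) (c : ConcState P) (k : Fin 3) :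
    ∀ᵐ x ∂P.muS, Integrable (fun r => deltaKernel P.eps0 (P.radius k) r * c.2 k (x, r))
      (volume.restrict (Icc 0 (P.radius k))) := by
  have : IsFiniteMeasure (P.muP k) := by
    rw [muP_eq_prod]; infer_instance
  have h1 : Integrable (c.2 k) (P.muP k) := (Lp.memLp (c.2 k)).integrable (by norm_num)
  filter_upwards [ae_integrable_of_muP h1] with x hx
  exact hx.bdd_mul (c := |1 / (P.eps0 * P.radius k)|)
    (measurable_deltaKernel _ _).aestronglyMeasurable
    (Eventually.of_forall fun r => abs_deltaKernel_le _ _ _)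

lemma cBar_add_ae (P : CellParams) (c d : ConcState P) (k : Fin 3) :
    ∀ᵐ x ∂P.muS, cBar P (c + d) k x = cBar P c k x + cBar P d k x := by
  have h1 := Lp.coeFn_add (c.2 k) (d.2 k)
  filter_upwards [ae_ae_of_ae_muP h1, ae_integrable_cBar P c k,
    ae_integrable_cBar P d k] with x hx hc hd
  rw [cBar_eq_setIntegral, cBar_eq_setIntegral, cBar_eq_setIntegral, ← integral_add hc hd]
  refine integral_congr_ae ?_
  filter_upwards [hx] with r hr
  rw [← mul_add]
  exact congrArg _ hr

lemma cBar_smul_ae (P : CellParams) (t : ℝ) (c : ConcState P) (k : Fin 3) :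
    ∀ᵐ x ∂P.muS, cBar P (t • c) k x = t * cBar P c k x := by
  have h1 := Lp.coeFn_smul t (c.2 k)
  filter_upwards [ae_ae_of_ae_muP h1] with x hx
  rw [cBar_eq_setIntegral, cBar_eq_setIntegral, ← integral_const_mul]
  refine integral_congr_ae ?_
  filter_upwards [hx] with r hr
  have hr' : ((t • c).2 k) (x, r) = t * c.2 k (x, r) := hr
  rw [hr']
  ring

lemma eLpNorm_two_sq {α : Type*} [MeasurableSpace α] (μ : Measure α) (f : α → ℝ) :
    eLpNorm f 2 μ ^ 2 = ∫⁻ x, ‖f x‖ₑ ^ 2 ∂μ := by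
  have := eLpNorm_nnreal_pow_eq_lintegral (f := f) (μ := μ) (p := 2) (by norm_num)
  simpa using this

/-- Averaging over the outer layer is bounded on `L²`: by the Cauchy-Schwarz inequality in `r` the
square of the average is at most a constant times `∫ |c_{k+1}(x, r)|² dr`. -/
lemma exists_eLpNorm_cBar_le (P : CellParams) (k : Fin 3) :
    ∃ K : NNReal, ∀ c : ConcState P, eLpNorm (cBar P c k) 2 P.muS ≤ K * ‖c‖ₑ := by
  set ν := volume.restrict (Icc 0 (P.radius k)) with hν
  set D : NNReal := ‖1 / (P.eps0 * P.radius k)‖₊ with hD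
  set m : NNReal := measureUnivNNReal ν with hm
  have hm' : (m : ENNReal) = ν univ := coe_measureUnivNNReal ν
  refine ⟨D * NNReal.sqrt m, fun c => ?_⟩
  have hc : eLpNorm (c.2 k) 2 (P.muP k) ≤ ‖c‖ₑ := by
    rw [← Lp.enorm_def]
    refine enorm_le_iff_norm_le.2 ?_
    exact (norm_le_pi_norm c.2 k).trans (norm_snd_le c)
  have hmeas : Measurable fun q => ‖c.2 k q‖ₑ ^ 2 :=
    (Lp.stronglyMeasurable (c.2 k)).measurable.enorm.pow_const 2
  have h1 : ∀ x, ‖cBar P c k x‖ₑ ^ 2 ≤ (D ^ 2 * m) * ∫⁻ r, ‖c.2 k (x, r)‖ₑ ^ 2 ∂ν := by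
    intro x
    have hsm : AEStronglyMeasurable (fun r => c.2 k (x, r)) ν :=
      ((Lp.stronglyMeasurable (c.2 k)).comp_measurable measurable_prodMk_left).aestronglyMeasurable
    have e1 : ‖cBar P c k x‖ₑ ≤ D * ∫⁻ r, ‖c.2 k (x, r)‖ₑ ∂ν := by
      rw [cBar_eq_setIntegral, ← lintegral_const_mul' _ _ ENNReal.coe_ne_top]
      refine (enorm_integral_le_lintegral_enorm _).trans (lintegral_mono fun r => ?_)
      rw [enorm_mul]
      gcongr
      exact enorm_le_iff_norm_le.2 (abs_deltaKernel_le _ _ _)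
    have e2 : ∫⁻ r, ‖c.2 k (x, r)‖ₑ ∂ν
        ≤ eLpNorm (fun r => c.2 k (x, r)) 2 ν * ν univ ^ (1 / 2 : ℝ) := by
      have := eLpNorm_le_eLpNorm_mul_rpow_measure_univ (p := 1) (q := 2) (by norm_num) hsm
      rw [eLpNorm_one_eq_lintegral_enorm] at this
      convert this using 3
      norm_num
    calc ‖cBar P c k x‖ₑ ^ 2
        ≤ (D * (eLpNorm (fun r => c.2 k (x, r)) 2 ν * ν univ ^ (1 / 2 : ℝ))) ^ 2 := by
          gcongr
          exact e1.trans (by gcongr)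
      _ = _ := by
          rw [mul_pow, mul_pow, eLpNorm_two_sq, ← ENNReal.rpow_natCast (ν univ ^ (1 / 2 : ℝ)),
            ← ENNReal.rpow_mul, hm']
          norm_num
          ring
  have h2 : eLpNorm (cBar P c k) 2 P.muS ^ 2 ≤ (D * NNReal.sqrt m * ‖c‖ₑ) ^ 2 := by
    rw [eLpNorm_two_sq]
    calc _ ≤ ∫⁻ x, (D ^ 2 * m) * ∫⁻ r, ‖c.2 k (x, r)‖ₑ ^ 2 ∂ν ∂P.muS := lintegral_mono h1
      _ = (D ^ 2 * m) * eLpNorm (c.2 k) 2 (P.muP k) ^ 2 := by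
          rw [lintegral_const_mul' _ _ (by finiteness), eLpNorm_two_sq,
            lintegral_muP hmeas]
      _ ≤ (D ^ 2 * m) * ‖c‖ₑ ^ 2 := by gcongr
      _ = _ := by
          rw [mul_pow, mul_pow, ← ENNReal.coe_pow (NNReal.sqrt m), NNReal.sq_sqrt]
  push_cast
  exact (ENNReal.pow_le_pow_left_iff (by norm_num)).1 h2

lemma memLp_cBar (P : CellParams) (c : ConcState P) (k : Fin 3) :
    MemLp (cBar P c k) 2 P.muS := by
  obtain ⟨K, hK⟩ := exists_eLpNorm_cBar_le P k
  exact ⟨(measurable_cBar P c k).aestronglyMeasurable, (hK c).trans_lt (by finiteness)⟩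

/-- The averaged surface concentration, as a bounded operator from `𝒳` to `L²(L₁, L)`. -/
def cBarCLM (P : CellParams) (k : Fin 3) : ConcState P →L[ℝ] Lp ℝ 2 P.muS :=
  LinearMap.mkContinuousOfExistsBound
    { toFun := fun c => (memLp_cBar P c k).toLp
      map_add' := fun c d => by
        rw [← MemLp.toLp_add]
        exact (MemLp.toLp_eq_toLp_iff _ _).2 (cBar_add_ae P c d k)
      map_smul' := fun t c => by
        rw [RingHom.id_apply, ← MemLp.toLp_const_smul]
        exact (MemLp.toLp_eq_toLp_iff _ _).2 (cBar_smul_ae P t c k) }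
    (by
      obtain ⟨K, hK⟩ := exists_eLpNorm_cBar_le P k
      refine ⟨K, fun c => ?_⟩
      have h := ENNReal.toReal_mono (by finiteness) (hK c)
      rw [ENNReal.toReal_mul, toReal_enorm] at h
      exact (Lp.norm_toLp _ (memLp_cBar P c k)).trans_le h)

lemma cBarCLM_ae (P : CellParams) (k : Fin 3) (c : ConcState P) :
    ∀ᵐ x ∂P.muS, cBarCLM P k c x = cBar P c k x :=
  (memLp_cBar P c k).coeFn_toLp

/-! ### Differentiability of the source term -/

/-- `a_k` times the derivative of the `k`-th exchange current density with respect to the averaged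
concentration. -/
def sourceConc (P : CellParams) (cyc : Cycle) (c : ConcState P) (φ : PotState P) (k : Fin 3)
    (x : ℝ) : ℝ :=
  P.a k * (Icc P.L1 P.L).indicator
    (fun x => rateDerivConc P cyc (cBar P c k x) (φ.1 x) (φ.2 x)) x

lemma IsWeight.const_mul {P : CellParams} {g : ℝ → ℝ} (hg : IsWeight P g) (r : ℝ) :
    IsWeight P (fun x => r * g x) := by
  obtain ⟨C, hC0, hC⟩ := hg.bdd
  refine ⟨hg.meas.const_mul r, ⟨|r| * C, by positivity, fun x => ?_⟩, fun x hx => ?_⟩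
  · rw [abs_mul]
    exact mul_le_mul_of_nonneg_left (hC x) (abs_nonneg _)
  · rw [hg.supp x hx, mul_zero]

lemma isWeight_sourceConc (P : CellParams) (cyc : Cycle) (c : ConcState P) (φ : PotState P)
    (k : Fin 3) : IsWeight P (sourceConc P cyc c φ k) := by
  refine IsWeight.const_mul (IsWeight.indicator ?_ ?_) _
  · exact ((measurable_rateDeriv P cyc c φ k).mul
      ((measurable_deriv _).comp (measurable_cBar P c k))).neg
  · obtain ⟨C, hC0, hC⟩ := exists_bound_rateDerivConc P cyc
    exact ⟨C, hC0, fun x => hC _ _ _⟩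

/-- The source term as a map `𝒳 × 𝒴 → L¹(ℝ)`. -/
def sourceL1 (P : CellParams) (cyc : Cycle) (z : ConcState P × PotState P) : ℝ →₁[volume] ℝ :=
  (isWeight_source P cyc z.1 z.2).integrable.toL1

/-- The derivative of the source term with respect to the potentials. -/
def sourceDerivPot (P : CellParams) (cyc : Cycle) (z : ConcState P × PotState P) :
    PotState P →L[ℝ] (ℝ →₁[volume] ℝ) :=
  ((isWeight_source₁ P cyc z.1 z.2).mulL1 (Icc_subset P)).coprod
    ((isWeight_source₂ P cyc z.1 z.2).mulL1 subset_rfl)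

/-- The derivative of the source term with respect to the concentrations. -/
def sourceDerivConc (P : CellParams) (cyc : Cycle) (z : ConcState P × PotState P) :
    ConcState P →L[ℝ] (ℝ →₁[volume] ℝ) :=
  ∑ k, ((isWeight_sourceConc P cyc z.1 z.2 k).mulL1 subset_rfl).comp (cBarCLM P k)

lemma setIntegral_sq_le {P : CellParams} {a b : ℝ} (hab : Icc P.L1 P.L ⊆ Icc a b)
    (h : Lp ℝ 2 (volume.restrict (Icc a b))) :
    IntegrableOn (fun x => h x ^ 2) (Icc P.L1 P.L) ∧
      ∫ x in Icc P.L1 P.L, h x ^ 2 ≤ ‖h‖ ^ 2 := by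
  have h1 : IntegrableOn (fun x => h x ^ 2) (Icc a b) := (Lp.memLp h).integrable_sq
  have h2 : ∫ x in Icc a b, h x ^ 2 = ‖h‖ ^ 2 := by
    rw [← real_inner_self_eq_norm_sq, L2.inner_def]
    simp [sq]
  refine ⟨h1.mono_set hab, ?_⟩
  rw [← h2]
  exact setIntegral_mono_set h1 (Eventually.of_forall fun x => sq_nonneg _) hab.eventuallyLE

lemma ae_of_ae_restrict {s t : Set ℝ} (hs : MeasurableSet s) (hts : t ⊆ s) {p : ℝ → Prop}
    (h : ∀ᵐ x ∂volume.restrict s, p x) : ∀ᵐ x, x ∈ t → p x := by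
  filter_upwards [(ae_restrict_iff' hs).1 h] with x hx hxt using hx (hts hxt)

/-- The pointwise Taylor estimate for the source term. It holds almost everywhere only, because the
representatives of `φ + h` and `c + d` are sums only up to null sets. -/
lemma exists_source_taylor (P : CellParams) (cyc : Cycle) :
    ∃ C, 0 ≤ C ∧ ∀ (c d : ConcState P) (φ h : PotState P), ∀ᵐ x,
      |source P cyc (c + d) (φ + h) x - source P cyc c φ x
        - (source₁ P cyc c φ x * h.1 x + source₂ P cyc c φ x * h.2 x
          + ∑ k, sourceConc P cyc c φ k x * cBarCLM P k d x)|
      ≤ (Icc P.L1 P.L).indicator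
        (fun x => C * ∑ k, (cBarCLM P k d x ^ 2 + h.1 x ^ 2 + h.2 x ^ 2)) x := by
  obtain ⟨C, hC0, hC⟩ := exists_rate_taylor P cyc
  have hA : 0 ≤ ∑ k, |P.a k| := Finset.sum_nonneg fun k _ => abs_nonneg _
  refine ⟨C * ∑ k, |P.a k|, by positivity, fun c d φ h => ?_⟩
  have h1 : ∀ᵐ x, x ∈ Icc P.L1 P.L → (φ + h).1 x = φ.1 x + h.1 x :=
    ae_of_ae_restrict measurableSet_Icc (Icc_subset P) (Lp.coeFn_add φ.1 h.1)
  have h2 : ∀ᵐ x, x ∈ Icc P.L1 P.L → (φ + h).2 x = φ.2 x + h.2 x :=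
    ae_of_ae_restrict measurableSet_Icc subset_rfl (Lp.coeFn_add φ.2 h.2)
  have h3 : ∀ᵐ x, ∀ k, x ∈ Icc P.L1 P.L → cBar P (c + d) k x = cBar P c k x + cBar P d k x :=
    ae_all_iff.2 fun k => ae_of_ae_restrict measurableSet_Icc subset_rfl (cBar_add_ae P c d k)
  have h4 : ∀ᵐ x, ∀ k, x ∈ Icc P.L1 P.L → cBarCLM P k d x = cBar P d k x :=
    ae_all_iff.2 fun k => ae_of_ae_restrict measurableSet_Icc subset_rfl (cBarCLM_ae P k d)
  filter_upwards [h1, h2, h3, h4] with x h1 h2 h3 h4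
  by_cases hx : x ∈ Icc P.L1 P.L
  · simp only [source, source₁, source₂, sourceConc, current, current₁, current₂,
      indicator_of_mem hx, h1 hx, h2 hx, h3 _ hx, h4 _ hx, deriv_rate₁, deriv_rate₂]
    rw [Finset.sum_mul, Finset.sum_mul, ← Finset.sum_add_distrib, ← Finset.sum_add_distrib,
      ← Finset.sum_sub_distrib, ← Finset.sum_sub_distrib, mul_assoc, Finset.sum_mul_sum,
      Finset.mul_sum]
    refine (Finset.abs_sum_le_sum_abs _ _).trans (Finset.sum_le_sum fun k _ => ?_)
    have key := hC (cBar P c k x) (φ.1 x) (φ.2 x) (cBar P d k x) (h.1 x) (h.2 x)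
    rw [← Finset.mul_sum, mul_left_comm]
    calc _ = |P.a k| * |rate P cyc (cBar P c k x + cBar P d k x) (φ.1 x + h.1 x) (φ.2 x + h.2 x)
            - rate P cyc (cBar P c k x) (φ.1 x) (φ.2 x)
            - (rateDerivConc P cyc (cBar P c k x) (φ.1 x) (φ.2 x) * cBar P d k x
              - rateDeriv P cyc (cBar P c k x) (φ.1 x) (φ.2 x) * h.1 x
              + rateDeriv P cyc (cBar P c k x) (φ.1 x) (φ.2 x) * h.2 x)| := by
          rw [← abs_mul]
          congr 1
          ring
      _ ≤ |P.a k| * (C * (cBar P d k x ^ 2 + h.1 x ^ 2 + h.2 x ^ 2)) := by gcongr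
      _ ≤ _ := by
          gcongr
          exact Finset.single_le_sum
            (f := fun k => cBar P d k x ^ 2 + h.1 x ^ 2 + h.2 x ^ 2)
            (fun k _ => by positivity) (Finset.mem_univ k)
  · simp [(isWeight_source P cyc _ _).supp x hx, (isWeight_source₁ P cyc _ _).supp x hx,
      (isWeight_source₂ P cyc _ _).supp x hx, (isWeight_sourceConc P cyc _ _ _).supp x hx, hx]

lemma sourceDeriv_apply_ae (P : CellParams) (cyc : Cycle) (c d : ConcState P)
    (φ h : PotState P) : ∀ᵐ x,
      (sourceDerivPot P cyc (c, φ) h + sourceDerivConc P cyc (c, φ) d : ℝ →₁[volume] ℝ) x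
        = source₁ P cyc c φ x * h.1 x + source₂ P cyc c φ x * h.2 x
          + ∑ k, sourceConc P cyc c φ k x * cBarCLM P k d x := by
  have i₁ := (isWeight_source₁ P cyc c φ).integrable_mul (Icc_subset P) h.1
  have i₂ := (isWeight_source₂ P cyc c φ).integrable_mul subset_rfl h.2
  have j := fun k => (isWeight_sourceConc P cyc c φ k).integrable_mul subset_rfl (cBarCLM P k d)
  have e : sourceDerivPot P cyc (c, φ) h + sourceDerivConc P cyc (c, φ) d
      = i₁.toL1 + i₂.toL1 + ((j 0).toL1 + (j 1).toL1 + (j 2).toL1) := by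
    simp only [sourceDerivPot, sourceDerivConc, ContinuousLinearMap.coprod_apply,
      Fin.sum_univ_three]
    rfl
  rw [e, ← Integrable.toL1_add, ← Integrable.toL1_add, ← Integrable.toL1_add,
    ← Integrable.toL1_add]
  filter_upwards [((i₁.add i₂).add (((j 0).add (j 1)).add (j 2))).coeFn_toL1] with x hx
  rw [hx, Fin.sum_univ_three]
  rfl

/-- The source term is a substitution operator from `L²` to `L¹`. As the reaction rate has a
quadratic Taylor remainder, so has the operator: squares of `L²` functions are integrable. -/
lemma exists_sourceL1_quadratic (P : CellParams) (cyc : Cycle) :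
    ∃ C, ∀ z d : ConcState P × PotState P,
      ‖sourceL1 P cyc (z + d) - sourceL1 P cyc z
        - ((sourceDerivConc P cyc z).coprod (sourceDerivPot P cyc z)) d‖ ≤ C * ‖d‖ ^ 2 := by
  obtain ⟨C, hC0, hC⟩ := exists_source_taylor P cyc
  refine ⟨C * ∑ k, (‖cBarCLM P k‖ ^ 2 + 1 + 1), ?_⟩
  rintro ⟨c, φ⟩ ⟨d, h⟩
  have n₁ : ‖h.1‖ ≤ ‖(d, h)‖ := (norm_fst_le h).trans (norm_snd_le (d, h))
  have n₂ : ‖h.2‖ ≤ ‖(d, h)‖ := (norm_snd_le h).trans (norm_snd_le (d, h))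
  have n₃ : ∀ k, ‖cBarCLM P k d‖ ≤ ‖cBarCLM P k‖ * ‖(d, h)‖ := fun k =>
    ((cBarCLM P k).le_opNorm d).trans (by gcongr; exact norm_fst_le (d, h))
  have s₁ := setIntegral_sq_le (Icc_subset P) h.1
  have s₂ := setIntegral_sq_le (P := P) subset_rfl h.2
  have s₃ := fun k => setIntegral_sq_le (P := P) subset_rfl (cBarCLM P k d)
  have hint : ∀ k, IntegrableOn (fun x => cBarCLM P k d x ^ 2 + h.1 x ^ 2 + h.2 x ^ 2)
      (Icc P.L1 P.L) := fun k => ((s₃ k).1.add s₁.1).add s₂.1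
  have hint' : IntegrableOn
      (fun x => C * ∑ k, (cBarCLM P k d x ^ 2 + h.1 x ^ 2 + h.2 x ^ 2)) (Icc P.L1 P.L) :=
    (integrable_finsetSum _ fun k _ => hint k).const_mul C
  have hle : ∀ᵐ x, ‖(sourceL1 P cyc ((c, φ) + (d, h)) - sourceL1 P cyc (c, φ)
        - ((sourceDerivConc P cyc (c, φ)).coprod (sourceDerivPot P cyc (c, φ))) (d, h)
          : ℝ →₁[volume] ℝ) x‖
      ≤ (Icc P.L1 P.L).indicator
        (fun x => C * ∑ k, (cBarCLM P k d x ^ 2 + h.1 x ^ 2 + h.2 x ^ 2)) x := by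
    rw [ContinuousLinearMap.coprod_apply, add_comm (sourceDerivConc P cyc (c, φ) d)]
    set W := sourceDerivPot P cyc (c, φ) h + sourceDerivConc P cyc (c, φ) d with hW
    filter_upwards [hC c d φ h, Lp.coeFn_sub (sourceL1 P cyc ((c, φ) + (d, h))
        - sourceL1 P cyc (c, φ)) W,
      Lp.coeFn_sub (sourceL1 P cyc ((c, φ) + (d, h))) (sourceL1 P cyc (c, φ)),
      (isWeight_source P cyc (c + d) (φ + h)).integrable.coeFn_toL1,
      (isWeight_source P cyc c φ).integrable.coeFn_toL1,
      sourceDeriv_apply_ae P cyc c d φ h] with x h0 h1 h2 h3 h4 h5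
    have h3' : sourceL1 P cyc ((c, φ) + (d, h)) x = source P cyc (c + d) (φ + h) x := h3
    have h4' : sourceL1 P cyc (c, φ) x = source P cyc c φ x := h4
    rw [h1, Pi.sub_apply, h2, Pi.sub_apply, h3', h4', h5]
    exact h0
  rw [L1.norm_eq_integral_norm]
  calc _ ≤ ∫ x, (Icc P.L1 P.L).indicator
        (fun x => C * ∑ k, (cBarCLM P k d x ^ 2 + h.1 x ^ 2 + h.2 x ^ 2)) x :=
        integral_mono_ae (L1.integrable_coeFn _).norm
          (hint'.integrable_indicator measurableSet_Icc) hle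
    _ = C * ∑ k, ((∫ x in Icc P.L1 P.L, cBarCLM P k d x ^ 2) + (∫ x in Icc P.L1 P.L, h.1 x ^ 2)
          + ∫ x in Icc P.L1 P.L, h.2 x ^ 2) := by
        rw [integral_indicator measurableSet_Icc, integral_const_mul,
          integral_finsetSum _ fun k _ => hint k]
        congr 1
        refine Finset.sum_congr rfl fun k _ => ?_
        have i : IntegrableOn (fun x => cBarCLM P k d x ^ 2 + h.1 x ^ 2) (Icc P.L1 P.L) :=
          (s₃ k).1.add s₁.1
        rw [integral_add i s₂.1, integral_add (s₃ k).1 s₁.1]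
    _ ≤ C * ∑ k, ((‖cBarCLM P k‖ * ‖(d, h)‖) ^ 2 + ‖(d, h)‖ ^ 2 + ‖(d, h)‖ ^ 2) := by
        gcongr with k
        · exact (s₃ k).2.trans (pow_le_pow_left₀ (norm_nonneg _) (n₃ k) 2)
        · exact s₁.2.trans (pow_le_pow_left₀ (norm_nonneg _) n₁ 2)
        · exact s₂.2.trans (pow_le_pow_left₀ (norm_nonneg _) n₂ 2)
    _ = _ := by
        rw [mul_assoc, Finset.sum_mul]
        congr 1
        refine Finset.sum_congr rfl fun k _ => ?_
        ring

/-! ### Functions with an absolutely continuous derivative -/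

lemma hasDerivAt_doubleInt {w : ℝ → ℝ} (hw : Integrable w) (x : ℝ) :
    HasDerivAt (doubleInt w) (∫ s in (0 : ℝ)..x, w s) x :=
  ((continuous_primitive hw).integral_hasStrictDerivAt 0 x).hasDerivAt

lemma IsW2Rep.integral_eq {a b : ℝ} {f u v : ℝ → ℝ} (h : IsW2Rep a b f u v) {x : ℝ}
    (hx : x ∈ Icc a b) : ∫ y in a..x, v y = u x - u a := by
  have hab : a ≤ b := hx.1.trans hx.2
  have hv : ContinuousOn v (uIcc a b) := h.absCont.continuousOn
  have hsub : uIcc a x ⊆ uIcc a b := uIcc_subset_uIcc_left (by rwa [uIcc_of_le hab])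
  refine intervalIntegral.integral_eq_sub_of_hasDerivAt_of_le hx.1 ?_ ?_ ?_
  · exact fun t ht => ((h.hasDeriv t ⟨ht.1, ht.2.trans hx.2⟩).mono
      (Icc_subset_Icc_right hx.2)).continuousWithinAt
  · exact fun t ht => (h.hasDeriv t ⟨ht.1.le, ht.2.le.trans hx.2⟩).hasDerivAt
      (Icc_mem_nhds ht.1 (ht.2.trans_le hx.2))
  · exact (hv.mono hsub).intervalIntegrable

lemma IsW2Rep.integral_deriv_eq {a b m : ℝ} {f u v w : ℝ → ℝ} (h : IsW2Rep a b f u v)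
    (hw : ∀ᵐ x ∂volume.restrict (Icc a b), deriv (fun y => m * v y) x = w x) {x : ℝ}
    (hx : x ∈ Icc a b) : ∫ y in a..x, w y = m * v x - m * v a := by
  have hab : a ≤ b := hx.1.trans hx.2
  have hac : AbsolutelyContinuousOnInterval (fun y => m * v y) a x :=
    (h.absCont.const_mul m).mono (uIcc_subset_uIcc_left (by rwa [uIcc_of_le hab]))
  rw [← hac.integral_deriv_eq_sub]
  refine intervalIntegral.integral_congr_ae ?_
  filter_upwards [(ae_restrict_iff' measurableSet_Icc).1 hw] with y hy hy'
  rw [uIoc_of_le hx.1] at hy'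
  exact (hy ⟨hy'.1.le, hy'.2.trans hx.2⟩).symm

/-- The function `A + B x + m⁻¹ ∫₀ˣ∫₀ʸ w` is of class `W^{2,1}`, and `m` times its second
derivative is `w`. -/
lemma isW2Rep_of_ae_eq {a b m A B : ℝ} {f w : ℝ → ℝ} (hm : m ≠ 0)
    (h0 : (0 : ℝ) ≤ a) (hab : a ≤ b) (hw : Integrable w)
    (hf : ∀ᵐ x ∂volume.restrict (Icc a b), A + B * x + m⁻¹ * doubleInt w x = f x) :
    IsW2Rep a b f (fun x => A + B * x + m⁻¹ * doubleInt w x)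
      (fun x => B + m⁻¹ * ∫ s in (0 : ℝ)..x, w s) ∧
    ∀ᵐ x ∂volume.restrict (Icc a b),
      deriv (fun y => m * (B + m⁻¹ * ∫ s in (0 : ℝ)..y, w s)) x = w x := by
  refine ⟨⟨hf, fun x _ => ?_, ?_⟩, ?_⟩
  · have h1 := (((hasDerivAt_id x).const_mul B).const_add A).fun_add
      ((hasDerivAt_doubleInt hw x).const_mul m⁻¹)
    simpa using h1.hasDerivWithinAt
  · have h1 : AbsolutelyContinuousOnInterval (fun x => ∫ s in (0 : ℝ)..x, w s) 0 b :=
      hw.intervalIntegrable.absolutelyContinuousOnInterval_intervalIntegral left_mem_uIcc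
    have h2 : uIcc a b ⊆ uIcc 0 b := by
      rw [uIcc_of_le hab, uIcc_of_le (h0.trans hab)]
      exact Icc_subset_Icc_left h0
    have h3 : AbsolutelyContinuousOnInterval (fun _ : ℝ => B) a b :=
      ((LipschitzWith.const' B).lipschitzOnWith (K := 0)).absolutelyContinuousOnInterval
    exact h3.add ((h1.mono h2).const_mul m⁻¹)
  · refine ae_restrict_of_ae ?_
    filter_upwards [LocallyIntegrable.ae_hasDerivAt_integral hw.locallyIntegrable] with x hx
    have h1 := (((hx 0).const_mul m⁻¹).const_add B).const_mul m
    rw [h1.deriv, mul_inv_cancel_left₀ hm]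

lemma IsW2Rep.ae_differentiableAt {a b : ℝ} {f u v : ℝ → ℝ} (hab : a ≤ b)
    (h : IsW2Rep a b f u v) : ∀ᵐ x ∂volume.restrict (Icc a b), DifferentiableAt ℝ v x := by
  have h1 := h.absCont.ae_differentiableAt
  rw [uIcc_of_le hab] at h1
  exact (ae_restrict_iff' measurableSet_Icc).2 h1

lemma IsW2Rep.add_const_mul {a b : ℝ} {f f' u u' v v' : ℝ → ℝ} (h : IsW2Rep a b f u v)
    (h' : IsW2Rep a b f' u' v') (r : ℝ) :
    IsW2Rep a b (fun x => f x + r * f' x) (fun x => u x + r * u' x)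
      (fun x => v x + r * v' x) := by
  refine ⟨?_, fun x hx => (h.hasDeriv x hx).fun_add ((h'.hasDeriv x hx).const_mul r),
    h.absCont.add (h'.absCont.const_mul r)⟩
  filter_upwards [h.ae_eq, h'.ae_eq] with x hx hx'
  rw [hx, hx']

lemma IsW2Rep.congr {a b : ℝ} {f f' u v : ℝ → ℝ} (h : IsW2Rep a b f u v)
    (hf : ∀ x, f x = f' x) : IsW2Rep a b f' u v :=
  (funext hf : f = f') ▸ h

/-! ### The operator equation and the constraint equations -/

lemma IsWeight.primitive_eq_zero {P : CellParams} {w : ℝ → ℝ} (hw : IsWeight P w) {y : ℝ}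
    (hy : y ∈ Icc 0 P.L1) : ∫ s in (0 : ℝ)..y, w s = 0 := by
  refine intervalIntegral.integral_zero_ae ?_
  filter_upwards [(volume : Measure ℝ).ae_ne P.L1] with s hs hs'
  rw [uIoc_of_le hy.1] at hs'
  exact hw.supp s fun h => hs (le_antisymm (hs'.2.trans hy.2) h.1)

lemma IsWeight.doubleInt_L1 {P : CellParams} {w : ℝ → ℝ} (hw : IsWeight P w) :
    doubleInt w P.L1 = 0 := by
  have h : EqOn (fun y => ∫ s in (0 : ℝ)..y, w s) (fun _ => 0) (uIcc 0 P.L1) := by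
    rw [uIcc_of_le (L1_pos P).le]
    exact fun y hy => hw.primitive_eq_zero hy
  rw [doubleInt, intervalIntegral.integral_congr h, intervalIntegral.integral_zero]

lemma IsWeight.primitive_from_L1 {P : CellParams} {w : ℝ → ℝ} (hw : IsWeight P w) (y : ℝ) :
    ∫ s in P.L1..y, w s = ∫ s in (0 : ℝ)..y, w s := by
  rw [← intervalIntegral.integral_add_adjacent_intervals (μ := volume) (a := 0) (b := P.L1)
    (c := y)
    hw.integrable.intervalIntegrable hw.integrable.intervalIntegrable,
    hw.primitive_eq_zero ⟨(L1_pos P).le, le_rfl⟩, zero_add]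

lemma IsWeight.doubleInt_from_L1 {P : CellParams} {w : ℝ → ℝ} (hw : IsWeight P w) (x : ℝ) :
    ∫ y in P.L1..x, ∫ s in (0 : ℝ)..y, w s = doubleInt w x := by
  have hc := continuous_primitive hw.integrable
  have h := intervalIntegral.integral_add_adjacent_intervals (μ := volume) (a := 0) (b := P.L1)
    (c := x)
    (hc.intervalIntegrable _ _) (hc.intervalIntegrable _ _)
  have h0 := hw.doubleInt_L1
  rw [doubleInt] at h0
  rw [doubleInt, ← h, h0, zero_add]

lemma L_pos (P : CellParams) : 0 < P.L := (L1_pos P).trans (L1_lt_L P)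

lemma coeFn_O₁ (P : CellParams) (cyc : Cycle) (c : ConcState P) (φ : PotState P) (I c₀ φ₀ : ℝ) :
    ∀ᵐ x ∂P.muE, O₁ P cyc c φ I c₀ φ₀ x
      = (1 / P.kEff * ∫ s in (0 : ℝ)..P.L, source P cyc c φ s) * x - P.kappa * (c.1 x - c₀)
        - 1 / P.kEff * doubleInt (source P cyc c φ) x := by
  have hw := (isWeight_source P cyc c φ).integrable
  set s := 1 / P.kEff * ∫ s in (0 : ℝ)..P.L, source P cyc c φ s with hs
  set D := doubleIntLp (source P cyc c φ) hw 0 P.L with hD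
  filter_upwards [Lp.coeFn_sub (s • idLp P - P.kappa • (c.1 - Lp.const 2 P.muE c₀))
      ((1 / P.kEff) • D),
    Lp.coeFn_sub (s • idLp P) (P.kappa • (c.1 - Lp.const 2 P.muE c₀)),
    Lp.coeFn_smul s (idLp P), Lp.coeFn_smul P.kappa (c.1 - Lp.const 2 P.muE c₀),
    Lp.coeFn_sub c.1 (Lp.const 2 P.muE c₀), Lp.coeFn_smul (1 / P.kEff) D,
    (memLp_Icc continuous_id 0 P.L).coeFn_toLp,
    (memLp_Icc (continuous_doubleInt hw) 0 P.L).coeFn_toLp,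
    Lp.coeFn_const (p := 2) (μ := P.muE) c₀] with x h1 h2 h3 h4 h5 h6 h7 h8 h9
  have h7' : idLp P x = x := h7
  have h8' : D x = doubleInt (source P cyc c φ) x := h8
  change (s • idLp P - P.kappa • (c.1 - Lp.const 2 P.muE c₀) - (1 / P.kEff) • D : Lp ℝ 2 P.muE) x
    = _
  rw [h1, Pi.sub_apply, h2, Pi.sub_apply, h3, h4, h6, Pi.smul_apply, Pi.smul_apply, Pi.smul_apply,
    h5, Pi.sub_apply, h7', h8', h9]
  simp only [smul_eq_mul, Function.const_apply]

lemma coeFn_O₂ (P : CellParams) (cyc : Cycle) (c : ConcState P) (φ : PotState P) (I c₀ φ₀ : ℝ) :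
    ∀ᵐ x ∂P.muS, O₂ P cyc c φ I c₀ φ₀ x
      = φ₀ + 1 / P.sigmaEff * doubleInt (source P cyc c φ) x := by
  have hw := (isWeight_source P cyc c φ).integrable
  set D := doubleIntLp (source P cyc c φ) hw P.L1 P.L with hD
  filter_upwards [Lp.coeFn_add (Lp.const 2 P.muS φ₀) ((1 / P.sigmaEff) • D),
    Lp.coeFn_smul (1 / P.sigmaEff) D,
    (memLp_Icc (continuous_doubleInt hw) P.L1 P.L).coeFn_toLp,
    Lp.coeFn_const (p := 2) (μ := P.muS) φ₀] with x h1 h2 h3 h4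
  have h3' : D x = doubleInt (source P cyc c φ) x := h3
  change (Lp.const 2 P.muS φ₀ + (1 / P.sigmaEff) • D : Lp ℝ 2 P.muS) x = _
  rw [h1, Pi.add_apply, h2, Pi.smul_apply, h3', h4]
  simp only [smul_eq_mul, Function.const_apply]

lemma opO_eq_zero_iff (P : CellParams) (cyc : Cycle) (c : ConcState P) (φ : PotState P)
    (I c₀ φ₀ : ℝ) : opO P cyc c φ I c₀ φ₀ = 0 ↔
      (∀ᵐ x ∂P.muE, φ.1 x + P.kappa * c.1 x = P.kappa * c₀
        + (1 / P.kEff * ∫ s in (0 : ℝ)..P.L, source P cyc c φ s) * x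
        - 1 / P.kEff * doubleInt (source P cyc c φ) x) ∧
      (∀ᵐ x ∂P.muS, φ.2 x = φ₀ + 1 / P.sigmaEff * doubleInt (source P cyc c φ) x) ∧
      I + ∫ s in (0 : ℝ)..P.L, source P cyc c φ s = 0 := by
  have e1 : φ.1 = O₁ P cyc c φ I c₀ φ₀ ↔ ∀ᵐ x ∂P.muE, φ.1 x + P.kappa * c.1 x = P.kappa * c₀
        + (1 / P.kEff * ∫ s in (0 : ℝ)..P.L, source P cyc c φ s) * x
        - 1 / P.kEff * doubleInt (source P cyc c φ) x := by
    rw [Lp.ext_iff]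
    refine eventually_congr ?_
    filter_upwards [coeFn_O₁ P cyc c φ I c₀ φ₀] with x hx
    rw [hx]
    constructor <;> intro h <;> linarith
  have e2 : φ.2 = O₂ P cyc c φ I c₀ φ₀ ↔
      ∀ᵐ x ∂P.muS, φ.2 x = φ₀ + 1 / P.sigmaEff * doubleInt (source P cyc c φ) x := by
    rw [Lp.ext_iff]
    refine eventually_congr ?_
    filter_upwards [coeFn_O₂ P cyc c φ I c₀ φ₀] with x hx
    rw [hx]
  rw [← e1, ← e2]
  simp only [opO, O₃, Prod.mk_eq_zero, smul_eq_zero, P.kEff_pos.ne', P.sigmaEff_pos.ne', false_or,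
    sub_eq_zero, and_assoc]

/-- The operator equation `𝒪 = 0` is the constraint system integrated twice. -/
theorem opO_eq_zero_iff_isSolution (P : CellParams) (cyc : Cycle) (c : ConcState P)
    (φ : PotState P) (I c₀ φ₀ : ℝ) :
    opO P cyc c φ I c₀ φ₀ = 0 ↔ IsSolution P cyc c φ I c₀ φ₀ := by
  rw [opO_eq_zero_iff]
  have hW := isWeight_source P cyc c φ
  set w := source P cyc c φ with hw
  have hint := hW.integrable
  have hk := P.kEff_pos.ne'
  have hσ := P.sigmaEff_pos.ne'
  have hL := (L_pos P).le
  constructor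
  · rintro ⟨h1, h2, h3⟩
    refine ⟨?_, ?_⟩
    -- the slope at `0` is the one for which the derivative vanishes at `L`
    · obtain ⟨h4, h5⟩ := isW2Rep_of_ae_eq (a := 0) (b := P.L) (m := P.kEff) (A := P.kappa * c₀)
        (B := 1 / P.kEff * ∫ s in (0 : ℝ)..P.L, w s)
        (f := fun x => φ.1 x + P.kappa * c.1 x) (w := fun x => -w x) hk le_rfl hL hint.neg (by
          filter_upwards [h1] with x hx
          rw [hx]
          simp only [doubleInt, intervalIntegral.integral_neg, one_div]
          ring)
      refine ⟨_, _, h4, ?_, ?_, ?_⟩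
      · filter_upwards [h5] with x hx
        rw [hx]
        ring
      · simp [doubleInt]
      · simp only [intervalIntegral.integral_neg, one_div]
        ring
    · obtain ⟨h4, h5⟩ := isW2Rep_of_ae_eq (a := P.L1) (b := P.L) (m := P.sigmaEff) (A := φ₀)
        (B := 0) (f := φ.2) (w := w) hσ (L1_pos P).le (L1_lt_L P).le hint (by
          filter_upwards [h2] with x hx
          rw [hx, one_div]
          ring)
      refine ⟨_, _, h4, ?_, ?_, ?_, ?_⟩
      · filter_upwards [h5] with x hx
        rw [hx]
        exact sub_self _
      · rw [hW.primitive_eq_zero ⟨(L1_pos P).le, le_rfl⟩]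
        ring
      · rw [zero_add, neg_mul, mul_inv_cancel_left₀ hσ]
        linarith
      · rw [hW.doubleInt_L1]
        ring
  · rintro ⟨⟨u, v, huv, hode, hu0, hvL⟩, ⟨u', v', huv', hode', hv0', hvL', hu0'⟩⟩
    have hode₁ : ∀ᵐ x ∂P.muE, deriv (fun y => P.kEff * v y) x = -w x := by
      filter_upwards [hode] with x hx
      linarith
    have hode₂ : ∀ᵐ x ∂P.muS, deriv (fun y => P.sigmaEff * v' y) x = w x := by
      filter_upwards [hode'] with x hx
      linarith
    refine ⟨?_, ?_, ?_⟩
    -- `v` is determined by its value `0` at `L`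
    · have h1 : ∀ x ∈ Icc 0 P.L, v x
          = 1 / P.kEff * (∫ s in (0 : ℝ)..P.L, w s) - 1 / P.kEff * ∫ s in (0 : ℝ)..x, w s := by
        intro x hx
        have e1 := huv.integral_deriv_eq hode₁ hx
        have e2 := huv.integral_deriv_eq hode₁ (right_mem_Icc.2 hL)
        rw [intervalIntegral.integral_neg] at e1 e2
        rw [hvL] at e2
        field_simp
        linarith
      filter_upwards [huv.ae_eq, ae_restrict_mem measurableSet_Icc] with x hx hx'
      rw [← hx, ← hu0]
      have e3 := huv.integral_eq hx'
      have e4 : ∫ y in (0 : ℝ)..x, v y = ∫ y in (0 : ℝ)..x,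
          (1 / P.kEff * (∫ s in (0 : ℝ)..P.L, w s) - 1 / P.kEff * ∫ s in (0 : ℝ)..y, w s) := by
        refine intervalIntegral.integral_congr fun y hy => ?_
        rw [uIcc_of_le hx'.1] at hy
        exact h1 y ⟨hy.1, hy.2.trans hx'.2⟩
      rw [intervalIntegral.integral_sub (by simp)
        (((continuous_primitive hint).intervalIntegrable _ _).const_mul _),
        intervalIntegral.integral_const, intervalIntegral.integral_const_mul, smul_eq_mul,
        e3] at e4
      rw [doubleInt]
      linarith
    -- `v'` is determined by its value `0` at `L₁`
    · have h1 : ∀ x ∈ Icc P.L1 P.L, v' x = 1 / P.sigmaEff * ∫ s in (0 : ℝ)..x, w s := by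
        intro x hx
        have e1 := huv'.integral_deriv_eq hode₂ hx
        rw [hW.primitive_from_L1, hv0'] at e1
        rw [e1]
        field_simp
        ring
      filter_upwards [huv'.ae_eq, ae_restrict_mem measurableSet_Icc] with x hx hx'
      rw [← hx, ← hu0']
      have e3 := huv'.integral_eq hx'
      have e4 : ∫ y in P.L1..x, v' y
          = ∫ y in P.L1..x, 1 / P.sigmaEff * ∫ s in (0 : ℝ)..y, w s := by
        refine intervalIntegral.integral_congr fun y hy => ?_
        rw [uIcc_of_le hx'.1] at hy
        exact h1 y ⟨hy.1, hy.2.trans hx'.2⟩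
      rw [intervalIntegral.integral_const_mul, hW.doubleInt_from_L1, e3] at e4
      linarith
    · have e1 := huv'.integral_deriv_eq hode₂ (right_mem_Icc.2 (L1_lt_L P).le)
      rw [hW.primitive_from_L1, hv0'] at e1
      linarith

/-- If `c₁` is regular, `φ₁` is as regular as `φ₁ + κ c₁`, so the equations can be split. -/
theorem isSolution_iff_isStrongSolution (P : CellParams) (cyc : Cycle) (c : ConcState P)
    (φ : PotState P) (I c₀ φ₀ : ℝ) (hc : IsRegular P c c₀) :
    IsSolution P cyc c φ I c₀ φ₀ ↔ IsStrongSolution P cyc c φ I c₀ φ₀ := by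
  have hL := (L_pos P).le
  constructor
  · rintro ⟨⟨u, v, huv, hode, hu0, hvL⟩, hsol⟩
    obtain ⟨C, dC, hC, hC0, hCL⟩ := hc
    have hΦ := (huv.add_const_mul hC (-P.kappa)).congr (f' := φ.1) fun x => by ring
    refine ⟨⟨C, dC, _, _, hC, hΦ, ?_, hC0, hCL, ?_, ?_⟩, hsol⟩
    · filter_upwards [hode, huv.ae_differentiableAt hL, hC.ae_differentiableAt hL] with x hx hv hd
      rw [← hx, deriv_const_mul_field, deriv_const_mul_field, deriv_const_mul_field,
        deriv_fun_add hv (hd.const_mul _), deriv_const_mul_field]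
      ring
    · rw [hu0, hC0]
      ring
    · rw [hvL, hCL]
      ring
  · rintro ⟨⟨C, dC, Φ, dΦ, hC, hΦ, hode, hC0, hCL, hΦ0, hΦL⟩, hsol⟩
    refine ⟨⟨_, _, hΦ.add_const_mul hC P.kappa, ?_, ?_, ?_⟩, hsol⟩
    · filter_upwards [hode, hΦ.ae_differentiableAt hL, hC.ae_differentiableAt hL] with x hx hv hd
      rw [← hx, deriv_const_mul_field, deriv_const_mul_field, deriv_const_mul_field,
        deriv_fun_add hv (hd.const_mul _), deriv_const_mul_field]
      ring
    · rw [hΦ0, hC0]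
      ring
    · rw [hΦL, hCL]
      ring

/-! ### Differentiability of the operator `𝒪` -/

/-- The part of `𝒪` that does not involve the source term, as a bounded operator in
`((c, c₀, I), (φ, φ₀))`. -/
def linearPart (P : CellParams) :
    ((ConcState P × ℝ × ℝ) × (PotState P × ℝ)) →L[ℝ] (PotState P × ℝ) :=
  let π := ContinuousLinearMap.fst ℝ (ConcState P × ℝ × ℝ) (PotState P × ℝ)
  let ρ := ContinuousLinearMap.snd ℝ (ConcState P × ℝ × ℝ) (PotState P × ℝ)
  let c₁ := (ContinuousLinearMap.fst ℝ _ _).comp ((ContinuousLinearMap.fst ℝ _ _).comp π)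
  let c₀ := (ContinuousLinearMap.fst ℝ _ _).comp ((ContinuousLinearMap.snd ℝ _ _).comp π)
  let I := (ContinuousLinearMap.snd ℝ _ _).comp ((ContinuousLinearMap.snd ℝ _ _).comp π)
  let φ₁ := (ContinuousLinearMap.fst ℝ _ _).comp ((ContinuousLinearMap.fst ℝ _ _).comp ρ)
  let φ₂ := (ContinuousLinearMap.snd ℝ _ _).comp ((ContinuousLinearMap.fst ℝ _ _).comp ρ)
  let φ₀ := (ContinuousLinearMap.snd ℝ _ _).comp ρ
  ((P.kEff • (φ₁ + P.kappa • (c₁ - (Lp.constL 2 P.muE ℝ).comp c₀))).prod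
    (P.sigmaEff • (φ₂ - (Lp.constL 2 P.muS ℝ).comp φ₀))).prod I

/-- The dependence of `𝒪` on the source term `w`. -/
def sourcePart (P : CellParams) : (ℝ →₁[volume] ℝ) →L[ℝ] (PotState P × ℝ) :=
  ((doubleIntL1 0 P.L - (ContinuousLinearMap.toSpanSingleton ℝ (idLp P)).comp
    (primitiveL1 P.L)).prod (-doubleIntL1 P.L1 P.L)).prod (primitiveL1 P.L)

/-- `𝒪` as a function of the data `(c, c₀, I)` and the unknowns `(φ, φ₀)`. -/
def opPair (P : CellParams) (cyc : Cycle)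
    (u : (ConcState P × ℝ × ℝ) × (PotState P × ℝ)) : PotState P × ℝ :=
  opO P cyc u.1.1 u.2.1 u.1.2.2 u.1.2.1 u.2.2

/-- The projection onto `(c, φ)`. -/
def concPot (P : CellParams) :
    ((ConcState P × ℝ × ℝ) × (PotState P × ℝ)) →L[ℝ] (ConcState P × PotState P) :=
  (ContinuousLinearMap.fst ℝ _ _).prodMap (ContinuousLinearMap.fst ℝ _ _)

lemma opPair_eq (P : CellParams) (cyc : Cycle) (u : (ConcState P × ℝ × ℝ) × (PotState P × ℝ)) :
    opPair P cyc u = linearPart P u + sourcePart P (sourceL1 P cyc (concPot P u)) := by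
  obtain ⟨⟨c, c₀, I⟩, φ, φ₀⟩ := u
  have hw := (isWeight_source P cyc c φ).integrable
  have e1 : sourceL1 P cyc (concPot P ((c, c₀, I), φ, φ₀)) = hw.toL1 := rfl
  rw [e1]
  have hk := P.kEff_pos.ne'
  have hσ := P.sigmaEff_pos.ne'
  refine Prod.ext (Prod.ext ?_ ?_) ?_
  · change P.kEff • (φ.1 - O₁ P cyc c φ I c₀ φ₀)
      = P.kEff • (φ.1 + P.kappa • (c.1 - Lp.const 2 P.muE c₀))
        + (doubleIntL1 0 P.L hw.toL1 - primitiveL1 P.L hw.toL1 • idLp P)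
    rw [doubleIntL1_toL1, primitiveL1_toL1, O₁]
    match_scalars <;> field_simp
  · change P.sigmaEff • (φ.2 - O₂ P cyc c φ I c₀ φ₀)
      = P.sigmaEff • (φ.2 - Lp.const 2 P.muS φ₀) + -doubleIntL1 P.L1 P.L hw.toL1
    rw [doubleIntL1_toL1, O₂]
    match_scalars <;> field_simp
  · change I + _ = I + primitiveL1 P.L hw.toL1
    rw [primitiveL1_toL1]

lemma contDiff_opPair (P : CellParams) (cyc : Cycle) : ContDiff ℝ 1 (opPair P cyc) := by
  obtain ⟨C, hC⟩ := exists_sourceL1_quadratic P cyc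
  rw [funext (opPair_eq P cyc)]
  exact (linearPart P).contDiff.add
    ((sourcePart P).contDiff.comp ((contDiff_of_quadratic hC).comp (concPot P).contDiff))

lemma hasFDerivAt_opPair (P : CellParams) (cyc : Cycle)
    (u : (ConcState P × ℝ × ℝ) × (PotState P × ℝ)) :
    HasFDerivAt (opPair P cyc) (linearPart P + (sourcePart P).comp
      (((sourceDerivConc P cyc (concPot P u)).coprod (sourceDerivPot P cyc (concPot P u))).comp
        (concPot P))) u := by
  obtain ⟨C, hC⟩ := exists_sourceL1_quadratic P cyc
  rw [funext (opPair_eq P cyc)]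
  exact (linearPart P).hasFDerivAt.fun_add
    ((sourcePart P).hasFDerivAt.comp u
      ((hasFDerivAt_of_quadratic hC _).comp u (concPot P).hasFDerivAt))

lemma deriv_opPair_comp_inr (P : CellParams) (cyc : Cycle) (c : ConcState P) (φ : PotState P)
    (I c₀ φ₀ : ℝ) :
    (linearPart P + (sourcePart P).comp (((sourceDerivConc P cyc (c, φ)).coprod
      (sourceDerivPot P cyc (c, φ))).comp (concPot P))).comp
        (ContinuousLinearMap.inr ℝ (ConcState P × ℝ × ℝ) (PotState P × ℝ))
      = opDO P cyc c φ I c₀ φ₀ := by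
  refine ContinuousLinearMap.ext fun ⟨h, h₀⟩ => ?_
  have e0 : (((sourceDerivConc P cyc (c, φ)).coprod (sourceDerivPot P cyc (c, φ))).comp
      (concPot P)) (0, (h, h₀)) = (isWeight_source₁ P cyc c φ).mulL1 (Icc_subset P) h.1
        + (isWeight_source₂ P cyc c φ).mulL1 subset_rfl h.2 := by
    change sourceDerivConc P cyc (c, φ) 0 + sourceDerivPot P cyc (c, φ) h = _
    rw [map_zero, zero_add]
    rfl
  have e1 : (linearPart P + (sourcePart P).comp (((sourceDerivConc P cyc (c, φ)).coprod
      (sourceDerivPot P cyc (c, φ))).comp (concPot P))).comp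
        (ContinuousLinearMap.inr ℝ (ConcState P × ℝ × ℝ) (PotState P × ℝ)) (h, h₀)
      = linearPart P (0, (h, h₀)) + sourcePart P
        ((isWeight_source₁ P cyc c φ).mulL1 (Icc_subset P) h.1
          + (isWeight_source₂ P cyc c φ).mulL1 subset_rfl h.2) := by
    rw [← e0]
    rfl
  rw [e1]
  set w₁ := (isWeight_source₁ P cyc c φ).mulL1 (Icc_subset P) h.1 with hw₁
  set w₂ := (isWeight_source₂ P cyc c φ).mulL1 (b := P.L) subset_rfl h.2 with hw₂
  refine Prod.ext (Prod.ext ?_ ?_) ?_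
  · change P.kEff • (h.1 + P.kappa • (0 - Lp.constL 2 P.muE ℝ 0))
        + (doubleIntL1 0 P.L (w₁ + w₂) - primitiveL1 P.L (w₁ + w₂) • idLp P)
      = (P.kEff • h.1 + doubleIntCLM P _ (isWeight_source₁ P cyc c φ) 0 P.L (Icc_subset P) 0 P.L h.1
          - intCLM P _ (isWeight_source₁ P cyc c φ) 0 P.L (Icc_subset P) h.1 • idLp P)
        + (doubleIntCLM P _ (isWeight_source₂ P cyc c φ) P.L1 P.L subset_rfl 0 P.L h.2
          - intCLM P _ (isWeight_source₂ P cyc c φ) P.L1 P.L subset_rfl h.2 • idLp P)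
    rw [map_zero, map_add, map_add, hw₁, hw₂, primitiveL1_comp_mulL1, primitiveL1_comp_mulL1,
      doubleIntL1_comp_mulL1, doubleIntL1_comp_mulL1]
    module
  · change P.sigmaEff • (h.2 - Lp.constL 2 P.muS ℝ h₀) + -doubleIntL1 P.L1 P.L (w₁ + w₂)
      = -doubleIntCLM P _ (isWeight_source₁ P cyc c φ) 0 P.L (Icc_subset P) P.L1 P.L h.1
        + (P.sigmaEff • h.2
          - doubleIntCLM P _ (isWeight_source₂ P cyc c φ) P.L1 P.L subset_rfl P.L1 P.L h.2)
        - P.sigmaEff • (h₀ • Lp.const 2 P.muS (1 : ℝ))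
    have e2 : Lp.constL 2 P.muS ℝ h₀ = h₀ • Lp.const 2 P.muS (1 : ℝ) := by
      have := (Lp.constL (E := ℝ) 2 P.muS ℝ).map_smul h₀ 1
      rwa [smul_eq_mul, mul_one] at this
    rw [e2, map_add, hw₁, hw₂, doubleIntL1_comp_mulL1, doubleIntL1_comp_mulL1]
    module
  · change 0 + primitiveL1 P.L (w₁ + w₂)
      = intCLM P _ (isWeight_source₁ P cyc c φ) 0 P.L (Icc_subset P) h.1
        + intCLM P _ (isWeight_source₂ P cyc c φ) P.L1 P.L subset_rfl h.2
    rw [map_add, hw₁, hw₂, primitiveL1_comp_mulL1, primitiveL1_comp_mulL1, zero_add]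

lemma fderiv_opPair_comp_inr (P : CellParams) (cyc : Cycle) (c : ConcState P) (φ : PotState P)
    (I c₀ φ₀ : ℝ) :
    (fderiv ℝ (opPair P cyc) ((c, c₀, I), (φ, φ₀))).comp
      (ContinuousLinearMap.inr ℝ (ConcState P × ℝ × ℝ) (PotState P × ℝ))
      = opDO P cyc c φ I c₀ φ₀ := by
  rw [(hasFDerivAt_opPair P cyc _).fderiv]
  exact deriv_opPair_comp_inr P cyc c φ I c₀ φ₀

/-- `D𝒪` is the partial derivative of `𝒪` in `(φ, φ₀)`. -/
theorem hasFDerivAt_opO (P : CellParams) (cyc : Cycle) (c : ConcState P) (φ : PotState P)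
    (I c₀ φ₀ : ℝ) :
    HasFDerivAt (fun z : PotState P × ℝ => opO P cyc c z.1 I c₀ z.2)
      (opDO P cyc c φ I c₀ φ₀) (φ, φ₀) := by
  have h1 : HasFDerivAt (fun z : PotState P × ℝ => ((c, c₀, I), z))
      (ContinuousLinearMap.inr ℝ (ConcState P × ℝ × ℝ) (PotState P × ℝ)) (φ, φ₀) :=
    hasFDerivAt_prodMk_right (c, c₀, I) (φ, φ₀)
  have h2 := HasFDerivAt.comp (φ, φ₀) (hasFDerivAt_opPair P cyc ((c, c₀, I), (φ, φ₀))) h1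
  exact h2.congr_fderiv (deriv_opPair_comp_inr P cyc c φ I c₀ φ₀)

/-! ### Local solvability -/

/-- The implicit function theorem in terms of neighbourhoods: near a zero at which the partial
derivative in the second variable is invertible, the zero set is the graph of a differentiable
function over an open set. -/
theorem exists_implicit_neighborhoods {E G H : Type*} [NormedAddCommGroup E] [NormedSpace ℝ E]
    [CompleteSpace E] [NormedAddCommGroup G] [NormedSpace ℝ G] [CompleteSpace G]
    [NormedAddCommGroup H] [NormedSpace ℝ H] [CompleteSpace H] {f : E × G → H} {x : E} {y : G}
    (hf : ContDiffAt ℝ 1 f (x, y)) (h0 : f (x, y) = 0)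
    (hinv : ((fderiv ℝ f (x, y)).comp (ContinuousLinearMap.inr ℝ E G)).IsInvertible) :
    ∃ (U : Set E) (V : Set G) (ψ : E → G), IsOpen U ∧ x ∈ U ∧ IsOpen V ∧ y ∈ V ∧
      DifferentiableOn ℝ ψ U ∧ ψ x = y ∧ (∀ x' ∈ U, ψ x' ∈ V) ∧
      ∀ x' ∈ U, ∀ y' ∈ V, f (x', y') = 0 ↔ ψ x' = y' := by
  set ψ := hf.implicitFunction one_ne_zero hinv with hψ
  have hψx : ψ x = y := hf.implicitFunction_apply_self one_ne_zero hinv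
  have hψc : ContDiffAt ℝ 1 ψ x := hf.contDiffAt_implicitFunction one_ne_zero hinv
  have hiff := hf.eventually_apply_eq_iff_implicitFunction one_ne_zero hinv
  rw [h0, nhds_prod_eq] at hiff
  -- a box on which zeros are points of the graph, shrunk in the first factor so that `ψ` is
  -- differentiable there and maps it into the second factor
  obtain ⟨p, hp, q, hq, hpq⟩ := eventually_prod_iff.1 hiff
  obtain ⟨V, hVq, hV, hyV⟩ := eventually_nhds_iff.1 hq
  have hdiff : ∀ᶠ x' in 𝓝 x, DifferentiableAt ℝ ψ x' :=
    (hψc.eventually (by simp)).mono fun x' h => h.differentiableAt one_ne_zero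
  have hmem : ∀ᶠ x' in 𝓝 x, ψ x' ∈ V :=
    hψc.continuousAt.eventually_mem (by rw [hψx]; exact hV.mem_nhds hyV)
  obtain ⟨U, hU, hUo, hxU⟩ := eventually_nhds_iff.1 (hp.and (hdiff.and hmem))
  exact ⟨U, V, ψ, hUo, hxU, hV, hyV,
    fun x' hx' => (hU x' hx').2.1.differentiableWithinAt, hψx, fun x' hx' => (hU x' hx').2.2,
    fun x' hx' y' hy' => hpq (hU x' hx').1 (hVq y' hy')⟩

/-- Near a nonsingular solution, the solutions form the graph of a differentiable function of the
data `(c, c₀, I)`. -/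
theorem exists_local_solution (P : CellParams) (cyc : Cycle) (cs : ConcState P)
    (φs : PotState P) (Is c₀s φ₀s : ℝ) (hsol : IsSolution P cyc cs φs Is c₀s φ₀s)
    (hinv : (opDO P cyc cs φs Is c₀s φ₀s).IsInvertible) :
    ∃ (U : Set (ConcState P × ℝ × ℝ)) (V : Set (PotState P × ℝ))
      (ψ : ConcState P × ℝ × ℝ → PotState P × ℝ),
      IsOpen U ∧ (cs, c₀s, Is) ∈ U ∧ IsOpen V ∧ (φs, φ₀s) ∈ V ∧ DifferentiableOn ℝ ψ U ∧
      ψ (cs, c₀s, Is) = (φs, φ₀s) ∧ (∀ x ∈ U, ψ x ∈ V) ∧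
      ∀ (c : ConcState P) (c₀ I : ℝ), (c, c₀, I) ∈ U → ∀ z ∈ V,
        (IsSolution P cyc c z.1 I c₀ z.2 ↔ ψ (c, c₀, I) = z) := by
  have h0 : opPair P cyc ((cs, c₀s, Is), (φs, φ₀s)) = 0 :=
    (opO_eq_zero_iff_isSolution P cyc cs φs Is c₀s φ₀s).2 hsol
  have hinv' : ((fderiv ℝ (opPair P cyc) ((cs, c₀s, Is), (φs, φ₀s))).comp
      (ContinuousLinearMap.inr ℝ (ConcState P × ℝ × ℝ) (PotState P × ℝ))).IsInvertible :=
    (fderiv_opPair_comp_inr P cyc cs φs Is c₀s φ₀s).symm ▸ hinv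
  obtain ⟨U, V, ψ, hU, hxU, hV, hyV, hd, hψ, hmem, hiff⟩ :=
    exists_implicit_neighborhoods (contDiff_opPair P cyc).contDiffAt h0 hinv'
  exact ⟨U, V, ψ, hU, hxU, hV, hyV, hd, hψ, hmem, fun c c₀ I hx z hz =>
    (opO_eq_zero_iff_isSolution P cyc c z.1 I c₀ z.2).symm.trans (hiff _ hx z hz)⟩

end LiCell

end

open LiCell
theorem theorem1 (P : CellParams) (cyc : Cycle) :
    -- the operator `𝒪` is a reformulation of the constraint equations
    (∀ (c : ConcState P) (φ : PotState P) (I c₀ φ₀ : ℝ),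
      opO P cyc c φ I c₀ φ₀ = 0 ↔ IsSolution P cyc c φ I c₀ φ₀) ∧
    -- for regular electrolyte concentrations the constraint equations hold in the strong sense
    (∀ (c : ConcState P) (φ : PotState P) (I c₀ φ₀ : ℝ), IsRegular P c c₀ →
      (IsSolution P cyc c φ I c₀ φ₀ ↔ IsStrongSolution P cyc c φ I c₀ φ₀)) ∧
    -- `D𝒪` is the Fréchet derivative of `𝒪` with respect to `(φ, φ₂(L₁))`
    (∀ (c : ConcState P) (φ : PotState P) (I c₀ φ₀ : ℝ),
      HasFDerivAt (fun z : PotState P × ℝ => opO P cyc c z.1 I c₀ z.2)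
        (opDO P cyc c φ I c₀ φ₀) (φ, φ₀)) ∧
    -- local unique solvability near a solution at which `D𝒪` is nonsingular
    (∀ (cs : ConcState P) (φs : PotState P) (Is c₀s φ₀s : ℝ),
      IsSolution P cyc cs φs Is c₀s φ₀s →
      (opDO P cyc cs φs Is c₀s φ₀s).IsInvertible →
      ∃ (U : Set (ConcState P × ℝ × ℝ)) (V : Set (PotState P × ℝ))
        (R : ConcState P × ℝ × ℝ → PotState P),
        IsOpen U ∧ (cs, c₀s, Is) ∈ U ∧ IsOpen V ∧ (φs, φ₀s) ∈ V ∧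
        DifferentiableOn ℝ R U ∧ R (cs, c₀s, Is) = φs ∧
        ∀ (c : ConcState P) (c₀ I : ℝ), (c, c₀, I) ∈ U →
          (∃! z : PotState P × ℝ, z ∈ V ∧ IsSolution P cyc c z.1 I c₀ z.2) ∧
          ∀ z : PotState P × ℝ, z ∈ V → IsSolution P cyc c z.1 I c₀ z.2 →
            z.1 = R (c, c₀, I)) := by
  refine ⟨opO_eq_zero_iff_isSolution P cyc, isSolution_iff_isStrongSolution P cyc,
    hasFDerivAt_opO P cyc, fun cs φs Is c₀s φ₀s hsol hinv => ?_⟩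
  obtain ⟨U, V, ψ, hU, hxU, hV, hyV, hd, hψ, hmem, hiff⟩ :=
    exists_local_solution P cyc cs φs Is c₀s φ₀s hsol hinv
  refine ⟨U, V, fun x => (ψ x).1, hU, hxU, hV, hyV, hd.fst, congrArg Prod.fst hψ,
    fun c c₀ I hx => ⟨⟨ψ (c, c₀, I), ⟨hmem _ hx, (hiff c c₀ I hx _ (hmem _ hx)).2 rfl⟩, ?_⟩, ?_⟩⟩
  · rintro z ⟨hz, hz'⟩
    exact ((hiff c c₀ I hx z hz).1 hz').symm
  · intro z hz hz'
    exact congrArg Prod.fst ((hiff c c₀ I hx z hz).1 hz').symm
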